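/- Let $k$ be an algebraically closed field of characteristic zero and $\ell$ a prime. Let $G^c$ be a finite $\ell$-group that is a central extension of an abelian $\ell$-group $A$, i.e., there is a surjective homomorphism $G^c\to A$ whose kernel is contained in the center of $G^c$. Let $V$ be a finite-dimensional faithful linear representation of $G^c$ over $k$, and let $V/G^c=\operatorname{Spec} k[V]^{G^c}$. Then $V/G^c$ admits a toric rational tower: there exist $n\ge 0$ and a sequence of dominant rational maps over $k$ of algebraic varieties (integral separated schemes of finite type) over $k$ $$X_n \stackrel{\pi_n}{\dashrightarrow} X_{n-1} \dashrightarrow \cdots \dashrightarrow X_1 \stackrel{\pi_1}{\dashrightarrow} X_0 = V/G^c$$ such that (1) the source $X_n$ is rational over $k$, i.e., birational over $k$ to an affine space; (2) for every $i$, the generic fiber of $\pi_i$, a scheme over the function field $k(X_{i-1})$, is geometrically rational and geometrically irreducible (its base change to an algebraic closure of $k(X_{i-1})$ is irreducible and rational); and (3) for every $i$, the generic fiber of $\pi_i$ is birational over $k(X_{i-1})$ to a torsor under an algebraic torus over $k(X_{i-1})$. -/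

import Mathlib

open CategoryTheory CategoryTheory.Limits AlgebraicGeometry TensorProduct

universe u

/-! ### Varieties and rationality -/

/-- A variety over a field `k`: an integral separated scheme of finite type over `k`. -/
structure Variety (k : Type u) [Field k] where
  /-- The underlying scheme. -/
  toScheme : Scheme.{u}
  /-- The structure morphism. -/
  str : toScheme ⟶ Spec (CommRingCat.of k)
  isIntegral : IsIntegral toScheme
  isSeparated : IsSeparated str
  locallyOfFiniteType : LocallyOfFiniteType str
  quasiCompact : QuasiCompact str

attribute [instance] Variety.isIntegral

/-- An `S`-scheme is rational over `S` if it is birational over `S` to a finite-dimensional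
affine space over `S`. -/
def IsRational {S X : Scheme.{u}} (s : X ⟶ S) : Prop :=
  ∃ d : ℕ, Scheme.BirationalOver s (AffineSpace (ULift.{u} (Fin d)) S ↘ S)

/-- The base change to the algebraic closure of `K` is irreducible and rational. -/
def IsGeometricallyRationalIrreducible {K : Type u} [Field K] {F : Scheme.{u}}
    (s : F ⟶ Spec (CommRingCat.of K)) : Prop :=
  let c : Spec (CommRingCat.of (AlgebraicClosure K)) ⟶ Spec (CommRingCat.of K) :=
    Spec.map (CommRingCat.ofHom (algebraMap K (AlgebraicClosure K)))
  IrreducibleSpace (pullback s c : Scheme.{u}) ∧ IsRational (pullback.snd s c)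

/-! ### Algebraic tori and their torsors

Tori are affine group schemes, and torsors under affine group schemes over a field are affine,
so both are described by their coordinate rings. -/

/-- The affine group scheme `Spec H` over `K` is an algebraic torus: over the algebraic closure
of `K` it becomes isomorphic, as a group scheme, to `𝔾ₘ ^ r`, whose coordinate ring is the group
algebra of `ℤ ^ r`. -/
def IsTorus (K H : Type u) [Field K] [CommRing H] [HopfAlgebra K H] : Prop :=
  ∃ r : ℕ, Nonempty ((AlgebraicClosure K ⊗[K] H) ≃ₐc[AlgebraicClosure K]
    AddMonoidAlgebra (AlgebraicClosure K) (Fin r → ℤ))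

/-- The coaction `δ` makes `P = Spec B` a torsor (principal homogeneous space) under the affine
group scheme `T = Spec H` over the field `K`: it corresponds to a right action `P × T ⟶ P`,
the scheme `P` is nonempty, and `P × T ⟶ P × P`, `(p, t) ↦ (p, p t)`, is an isomorphism. -/
structure IsTorsor {K H B : Type u} [Field K] [CommRing H] [HopfAlgebra K H]
    [CommRing B] [Algebra K B] (δ : B →ₐ[K] B ⊗[K] H) : Prop where
  nontrivial : Nontrivial B
  /-- `(p s) t = p (s t)` -/
  coassoc : ((Algebra.TensorProduct.assoc K K K B H H).toAlgHom.comp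
      (Algebra.TensorProduct.map δ (AlgHom.id K H))).comp δ =
    (Algebra.TensorProduct.map (AlgHom.id K B) (Bialgebra.comulAlgHom K H)).comp δ
  /-- `p 1 = p` -/
  counit : ((Algebra.TensorProduct.rid K K B).toAlgHom.comp
      (Algebra.TensorProduct.map (AlgHom.id K B) (Bialgebra.counitAlgHom K H))).comp δ =
    AlgHom.id K B
  bijective : Function.Bijective
    (Algebra.TensorProduct.lift (Algebra.TensorProduct.includeLeft : B →ₐ[K] B ⊗[K] H) δ
      (fun _ _ => Commute.all _ _))

/-- The `K`-scheme `F` is birational over `K` to a torsor under an algebraic torus over `K`. -/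
def IsBirationalToTorusTorsor {K : Type u} [Field K] {F : Scheme.{u}}
    (s : F ⟶ Spec (CommRingCat.of K)) : Prop :=
  ∃ (H : Type u) (_ : CommRing H) (_ : HopfAlgebra K H)
    (B : Type u) (_ : CommRing B) (_ : Algebra K B) (δ : B →ₐ[K] B ⊗[K] H),
    IsTorus K H ∧ IsTorsor δ ∧
      Scheme.BirationalOver s (Spec.map (CommRingCat.ofHom (algebraMap K B)))

/-! ### Towers -/

/-- The structure morphism of the generic fiber of a partial map `f` from `X` to an integral
scheme `Y`, over the function field of `Y`. -/
noncomputable def genericFiberStr {X Y : Scheme.{u}} [IsIntegral Y] (f : X.PartialMap Y) :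
    pullback f.hom (Y.fromSpecStalk (genericPoint Y)) ⟶
      Spec (CommRingCat.of Y.functionField) :=
  pullback.snd f.hom (Y.fromSpecStalk (genericPoint Y))

/-- A dominant rational map over `k` between varieties whose generic fiber is geometrically
rational and irreducible, and birational to a torsor under an algebraic torus, over the function
field of the target. The generic fiber of a rational map is that of any partial map
representing it; it is well defined up to birational equivalence. -/
def IsToricFibration {k : Type u} [Field k] {X Y : Variety k}
    (p : X.toScheme.RationalMap Y.toScheme) : Prop :=
  p.compHom Y.str = X.str.toRationalMap ∧ p.IsDominant ∧
    ∃ f : X.toScheme.PartialMap Y.toScheme, f.toRationalMap = p ∧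
      IsGeometricallyRationalIrreducible (genericFiberStr f) ∧
      IsBirationalToTorusTorsor (genericFiberStr f)

/-- The `k`-scheme `Y` admits a toric rational tower: a sequence of toric fibrations
`X n ⤏ X (n - 1) ⤏ ⋯ ⤏ X 1 ⤏ X 0 ≅ Y` of varieties over `k` whose source `X n` is
rational over `k`. -/
def AdmitsToricRationalTower {k : Type u} [Field k] {Y : Scheme.{u}}
    (s : Y ⟶ Spec (CommRingCat.of k)) : Prop :=
  ∃ (n : ℕ) (X : Fin (n + 1) → Variety k)
    (p : ∀ i : Fin n, (X i.succ).toScheme.RationalMap (X i.castSucc).toScheme),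
    (∃ e : (X 0).toScheme ≅ Y, e.hom ≫ s = (X 0).str) ∧
      (∀ i, IsToricFibration (p i)) ∧ IsRational (X (Fin.last n)).str

/-! ### Linear quotients -/

/-- The action of a group element on the algebra `k[V] = Sym (V*)` of polynomial functions,
induced by the contragredient representation. -/
noncomputable def polynomialAction {k G V : Type*} [Field k] [Group G] [AddCommGroup V]
    [Module k V] (ρ : Representation k G V) (g : G) :
    SymmetricAlgebra k (Module.Dual k V) →ₐ[k] SymmetricAlgebra k (Module.Dual k V) :=
  SymmetricAlgebra.lift ((SymmetricAlgebra.ι k (Module.Dual k V)).comp (ρ.dual g))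

/-- The algebra `k[V]^G` of invariant polynomial functions. -/
noncomputable def invariantAlgebra {k G V : Type*} [Field k] [Group G] [AddCommGroup V]
    [Module k V] (ρ : Representation k G V) :
    Subalgebra k (SymmetricAlgebra k (Module.Dual k V)) :=
  ⨅ g : G, AlgHom.equalizer (polynomialAction ρ g) (AlgHom.id k _)

/-- The structure morphism over `k` of the quotient `V / G = Spec k[V]^G`. -/
noncomputable def linearQuotientStr {k V : Type u} {G : Type*} [Field k] [Group G]
    [AddCommGroup V] [Module k V] (ρ : Representation k G V) :
    Spec (CommRingCat.of (invariantAlgebra ρ)) ⟶ Spec (CommRingCat.of k) :=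
  Spec.map (CommRingCat.ofHom (algebraMap k (invariantAlgebra ρ)))

/-! The commutators of a central extension of an abelian group are central. The theorem is therefore
proved for every finite group of nilpotency class at most two, by induction on the order. The
statement that runs through the induction is `HasLinearTowers k G`: for every faithful action of `G`
on a purely transcendental field `Ω`, linear in suitable generators, each affine model of `Ω^G` has
a tower.

The steps of the towers come from monomial actions. Let `G` act faithfully on `L`, let `Γ` surject
onto `G`, and let `Γ` act on a group algebra `L[M]` compatibly with this, permuting monomials up to
scalars through `G`. The kernel acts diagonally, and its invariants are `L[M']` for a sublattice
`M'`. By Galois descent `L[M']^G` is a torsor over `L^G` under the torus obtained from the same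
permutation of exponents without scalars. Hence a tower for `Frac(L[M])^Γ` extends to one for `L^G`
(`MonomialAction.quotientHasTower`).

Three applications drive the induction. (a) `HasLinearTowers.of_surjective`: if `Γ → G` is onto with
abelian kernel, towers pass from `Γ` to `G`. The monomials are coordinates of representations
induced from the characters of the kernel, and they make `Γ` act faithfully. (b)
`HasLinearTowers.wreath`: towers pass from `H` to `μ_m^I ⋊ H`. After adjoining coordinates `y_i`
scaled by `μ_m^I` and a regular representation `w_h` of `H`, the no-name lemma replaces the old
coordinates by invariant ones. Kummer theory replaces each `y_i` by `y_i ^ m`, leaving a faithful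
linear action of `H` alone. (c) `HasLinearTowers.of_sup_eq_top`: if `G = NH` with `N` abelian and
normal, then `G` is a quotient of some `μ_m^N ⋊ H` with abelian kernel, so (b) and (a) carry towers
from `H` to `G`.

In a nontrivial group of class at most two, take `H` a maximal subgroup, `g ∉ H`, and `N` generated
by `g` and the center. Then (c) reduces `G` to the smaller group `H`. For the trivial group the
field is purely transcendental and the tower has length zero. -/

section Birational

/-! ### Birational comparison of affine models of one function field. -/

theorem Subalgebra.isLocalization_away_inclusion {K F : Type*} [Field K] [Field F] [Algebra K F]
    {S C : Subalgebra K F} (h : S ≤ C) {c : F} (hc : c ∈ S) (hc0 : c ≠ 0) (hinv : c⁻¹ ∈ C)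
    (hC : ∀ x ∈ C, ∃ n : ℕ, x * c ^ n ∈ S) :
    letI := (Subalgebra.inclusion h).toRingHom.toAlgebra
    IsLocalization.Away (⟨c, hc⟩ : S) C := by
  let := (Subalgebra.inclusion h).toRingHom.toAlgebra
  have hmap : ∀ s : S, ((algebraMap S C s : C) : F) = s := fun s => rfl
  refine IsLocalization.Away.mk (⟨c, hc⟩ : S) ?_ ?_ ?_
  · refine .of_mul_eq_one ⟨c⁻¹, hinv⟩ ?_
    apply Subtype.ext
    simp [hmap, hc0]
  · intro x
    obtain ⟨n, hn⟩ := hC x x.2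
    refine ⟨n, ⟨_, hn⟩, ?_⟩
    apply Subtype.ext
    simp [hmap]
  · intro a b hab
    refine ⟨0, ?_⟩
    have := congrArg (fun z : C => (z : F)) hab
    simp only [hmap] at this
    simp [Subtype.ext this]

theorem Subalgebra.FG.exists_common_denominator {K F : Type*} [Field K] [Field F] [Algebra K F]
    {S T : Subalgebra K F} (hT : T.FG) (hS : ∀ f : F, ∃ a ∈ S, ∃ b ∈ S, b ≠ 0 ∧ f * b = a) :
    ∃ c ∈ S, c ≠ 0 ∧ ∀ x ∈ T, ∃ n : ℕ, x * c ^ n ∈ S := by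
  classical
  obtain ⟨s, rfl⟩ := hT
  choose a ha b hb hb0 hab using hS
  refine ⟨∏ x ∈ s, b x, prod_mem fun x _ => hb x, Finset.prod_ne_zero_iff.2 fun x _ => hb0 x, ?_⟩
  set c := ∏ x ∈ s, b x
  have hc : c ∈ S := prod_mem fun x _ => hb x
  intro x hx
  induction hx using Algebra.adjoin_induction with
  | mem x hx =>
    refine ⟨1, ?_⟩
    have : c = b x * ∏ y ∈ s.erase x, b y := (Finset.mul_prod_erase s b hx).symm
    rw [pow_one, this, ← mul_assoc, hab]
    exact mul_mem (ha x) (prod_mem fun y _ => hb y)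
  | algebraMap r => exact ⟨0, by simp⟩
  | add x y _ _ hx hy =>
    obtain ⟨n, hn⟩ := hx
    obtain ⟨m, hm⟩ := hy
    refine ⟨n + m, ?_⟩
    have : (x + y) * c ^ (n + m) = x * c ^ n * c ^ m + y * c ^ m * c ^ n := by ring
    rw [this]
    exact add_mem (mul_mem hn (pow_mem hc _)) (mul_mem hm (pow_mem hc _))
  | mul x y _ _ hx hy =>
    obtain ⟨n, hn⟩ := hx
    obtain ⟨m, hm⟩ := hy
    refine ⟨n + m, ?_⟩
    have : (x * y) * c ^ (n + m) = (x * c ^ n) * (y * c ^ m) := by ring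
    rw [this]
    exact mul_mem hn hm

/-- One half of the comparison of two models of a function field: the subalgebra generated by
both and by suitable inverses is a localization of the first. -/
theorem Subalgebra.isLocalization_away_adjoin {K F : Type*} [Field K] [Field F] [Algebra K F]
    {S T C : Subalgebra K F} {c d : F} (hc : c ∈ S) (hc0 : c ≠ 0) (hd : d ∈ T) (hd0 : d ≠ 0)
    (hcT : ∀ x ∈ T, ∃ n : ℕ, x * c ^ n ∈ S)
    (hC : C = Algebra.adjoin K ((S : Set F) ∪ T ∪ {c⁻¹, d⁻¹})) :
    ∃ (h : S ≤ C) (e : S), e ≠ 0 ∧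
      letI := (Subalgebra.inclusion h).toRingHom.toAlgebra
      IsLocalization.Away e C := by
  -- The element `d` need only lie in `S[1/c]`, so `c ^ N` is used to bring it into `S`. Inverting
  -- `c * (d * c ^ N)` then inverts both `c` and `d`.
  obtain ⟨N, hN⟩ := hcT d hd
  have hSC : S ≤ C := hC ▸ fun x hx => Algebra.subset_adjoin (.inl (.inl hx))
  have hTC : T ≤ C := hC ▸ fun x hx => Algebra.subset_adjoin (.inl (.inr hx))
  have hcC : c⁻¹ ∈ C := hC ▸ Algebra.subset_adjoin (.inr (by simp))
  have hdC : d⁻¹ ∈ C := hC ▸ Algebra.subset_adjoin (.inr (by simp))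
  have heS : c * (d * c ^ N) ∈ S := mul_mem hc hN
  have he0 : c * (d * c ^ N) ≠ 0 := by simp [hc0, hd0]
  refine ⟨hSC, ⟨_, heS⟩, fun h => he0 (congrArg Subtype.val h),
    isLocalization_away_inclusion hSC heS he0 ?_ ?_⟩
  · rw [mul_inv, mul_inv, ← inv_pow]
    exact mul_mem hcC (mul_mem hdC (pow_mem hcC _))
  · set e := c * (d * c ^ N) with he
    intro x hx
    rw [hC] at hx
    induction hx using Algebra.adjoin_induction with
    | mem x hx =>
      rcases hx with (hx | hx) | hx
      · exact ⟨0, by simpa using hx⟩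
      · obtain ⟨n, hn⟩ := hcT x hx
        refine ⟨n, ?_⟩
        rw [he, mul_pow, ← mul_assoc]
        exact mul_mem hn (pow_mem hN _)
      · rcases hx with rfl | rfl
        · refine ⟨1, ?_⟩
          rw [pow_one, he, inv_mul_cancel_left₀ hc0]
          exact hN
        · refine ⟨1, ?_⟩
          have : d⁻¹ * e ^ 1 = c * c ^ N := by rw [he]; field_simp
          rw [this]
          exact mul_mem hc (pow_mem hc _)
    | algebraMap r => exact ⟨0, by simp⟩
    | add x y _ _ hx hy =>
      obtain ⟨n, hn⟩ := hx
      obtain ⟨m, hm⟩ := hy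
      refine ⟨n + m, ?_⟩
      have : (x + y) * e ^ (n + m) = x * e ^ n * e ^ m + y * e ^ m * e ^ n := by ring
      rw [this]
      exact add_mem (mul_mem hn (pow_mem heS _)) (mul_mem hm (pow_mem heS _))
    | mul x y _ _ hx hy =>
      obtain ⟨n, hn⟩ := hx
      obtain ⟨m, hm⟩ := hy
      refine ⟨n + m, ?_⟩
      have : (x * y) * e ^ (n + m) = (x * e ^ n) * (y * e ^ m) := by ring
      rw [this]
      exact mul_mem hn hm

theorem IsOpenImmersion.isDominant_of_isDomain {A C : Type u} [CommRing A] [CommRing C] [IsDomain A]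
    [Nontrivial C] (f : A →+* C)
    [IsOpenImmersion (Spec.map (CommRingCat.ofHom f))] :
    IsDominant (Spec.map (CommRingCat.ofHom f)) := by
  constructor
  have := (IsOpenImmersion.isOpen_range (Spec.map (CommRingCat.ofHom f))).dense
    (Set.range_nonempty _)
  exact this

theorem Subalgebra.birationalOver_of_inclusion {K F : Type u} [Field K] [Field F] [Algebra K F]
    {S C : Subalgebra K F} (h : S ≤ C) (e : S)
    (hloc : letI := (Subalgebra.inclusion h).toRingHom.toAlgebra
      IsLocalization.Away e C) :
    Scheme.BirationalOver (Spec.map (CommRingCat.ofHom (algebraMap K C)))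
      (Spec.map (CommRingCat.ofHom (algebraMap K S))) := by
  let := (Subalgebra.inclusion h).toRingHom.toAlgebra
  have hloc : IsLocalization.Away e C := hloc
  let f := Spec.map (CommRingCat.ofHom (Subalgebra.inclusion h).toRingHom)
  have h1 : IsOpenImmersion f := AlgebraicGeometry.IsOpenImmersion.of_isLocalization e
  have h2 : IsDominant f := IsOpenImmersion.isDominant_of_isDomain _
  refine Scheme.Hom.birationalOver f _ _ ?_
  rw [← Spec.map_comp]
  rfl

/-- Each of `S` and `T` lies in a localization of the other. After inverting the two denominators,
both spectra contain the spectrum of one common algebra as a dense open subscheme. -/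
theorem Subalgebra.birationalOver {K F : Type u} [Field K] [Field F] [Algebra K F]
    {S T : Subalgebra K F} (hSfg : S.FG) (hTfg : T.FG)
    (hS : ∀ f : F, ∃ a ∈ S, ∃ b ∈ S, b ≠ 0 ∧ f * b = a)
    (hT : ∀ f : F, ∃ a ∈ T, ∃ b ∈ T, b ≠ 0 ∧ f * b = a) :
    Scheme.BirationalOver (Spec.map (CommRingCat.ofHom (algebraMap K S)))
      (Spec.map (CommRingCat.ofHom (algebraMap K T))) := by
  obtain ⟨c, hc, hc0, hcT⟩ := hTfg.exists_common_denominator hS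
  obtain ⟨d, hd, hd0, hdS⟩ := hSfg.exists_common_denominator hT
  obtain ⟨h1, e1, -, hl1⟩ := Subalgebra.isLocalization_away_adjoin hc hc0 hd hd0 hcT rfl
  obtain ⟨h2, e2, -, hl2⟩ := Subalgebra.isLocalization_away_adjoin (K := K)
    (C := Algebra.adjoin K ((S : Set F) ∪ T ∪ {c⁻¹, d⁻¹})) hd hd0 hc hc0 hdS
    (by rw [Set.union_comm (S : Set F), Set.pair_comm])
  exact (Subalgebra.birationalOver_of_inclusion h1 e1 hl1).symm.trans
    (Subalgebra.birationalOver_of_inclusion h2 e2 hl2)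

theorem birationalOver_of_algEquiv {K A B : Type u} [Field K] [CommRing A] [CommRing B]
    [Algebra K A] [Algebra K B] (e : A ≃ₐ[K] B) :
    Scheme.BirationalOver (Spec.map (CommRingCat.ofHom (algebraMap K A)))
      (Spec.map (CommRingCat.ofHom (algebraMap K B))) := by
  let f : Spec (.of A) ⟶ Spec (.of B) := Spec.map (CommRingCat.ofHom (e.symm : B →+* A))
  have : IsIso f := inferInstanceAs (IsIso (Spec.map (e.symm.toRingEquiv.toCommRingCatIso.hom)))
  refine Scheme.Hom.birationalOver f _ _ ?_
  rw [← Spec.map_comp, ← CommRingCat.ofHom_comp]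
  congr 2
  exact e.symm.toAlgHom.comp_algebraMap

/-- Two affine varieties with the same function field are birational. -/
theorem birationalOver_of_isFractionRing {K F A B : Type u} [Field K] [Field F] [Algebra K F]
    [CommRing A] [CommRing B] [Algebra K A] [Algebra K B]
    [Algebra.FiniteType K A] [Algebra.FiniteType K B]
    (i : A →ₐ[K] F) (hi : Function.Injective i) (j : B →ₐ[K] F) (hj : Function.Injective j)
    (hA : ∀ f : F, ∃ a b, b ≠ 0 ∧ f * i b = i a) (hB : ∀ f : F, ∃ a b, b ≠ 0 ∧ f * j b = j a) :
    Scheme.BirationalOver (Spec.map (CommRingCat.ofHom (algebraMap K A)))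
      (Spec.map (CommRingCat.ofHom (algebraMap K B))) := by
  have key : ∀ {A : Type u} [CommRing A] [Algebra K A] [Algebra.FiniteType K A] (i : A →ₐ[K] F)
      (_ : Function.Injective i) (_ : ∀ f : F, ∃ a b, b ≠ 0 ∧ f * i b = i a),
      i.range.FG ∧ (∀ f : F, ∃ a ∈ i.range, ∃ b ∈ i.range, b ≠ 0 ∧ f * b = a) := by
    intro A _ _ _ i hi hA
    refine ⟨?_, fun f => ?_⟩
    · rw [← Algebra.map_top]
      exact Subalgebra.FG.map _ Algebra.FiniteType.out
    · obtain ⟨a, b, hb, h⟩ := hA f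
      exact ⟨i a, ⟨a, rfl⟩, i b, ⟨b, rfl⟩, by simpa using (map_ne_zero_iff i hi).2 hb, h⟩
  obtain ⟨h1, h2⟩ := key i hi hA
  obtain ⟨h3, h4⟩ := key j hj hB
  exact (birationalOver_of_algEquiv (AlgEquiv.ofInjective i hi)).trans
    ((Subalgebra.birationalOver h1 h3 h2 h4).trans
      (birationalOver_of_algEquiv (AlgEquiv.ofInjective j hj)).symm)

/-- The polynomial ring in the `x i` is a second affine model of `F`. -/
theorem isRational_of_algebraicIndependent {K F A : Type u} [Field K] [Field F] [Algebra K F]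
    [CommRing A] [Algebra K A] [Algebra.FiniteType K A]
    (i : A →ₐ[K] F) (hi : Function.Injective i) (hA : ∀ f : F, ∃ a b, b ≠ 0 ∧ f * i b = i a)
    {d : ℕ} (x : Fin d → F) (hx : AlgebraicIndependent K x)
    (htop : IntermediateField.adjoin K (Set.range x) = ⊤) :
    IsRational (Spec.map (CommRingCat.ofHom (algebraMap K A))) := by
  refine ⟨d, ?_⟩
  let P := MvPolynomial (ULift.{u} (Fin d)) K
  let j : P →ₐ[K] F := MvPolynomial.aeval (fun n => x n.down)
  have hj : Function.Injective j :=
    hx.comp (ULift.down : ULift.{u} (Fin d) → Fin d) ULift.down_injective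
  have hrange : j.range = Algebra.adjoin K (Set.range x) := by
    rw [← Algebra.adjoin_range_eq_range_aeval]
    congr 1
    ext y
    simp
  have h1 : Scheme.BirationalOver (Spec.map (CommRingCat.ofHom (algebraMap K A)))
      (Spec.map (CommRingCat.ofHom (algebraMap K P))) := by
    refine birationalOver_of_isFractionRing i hi j hj hA fun f => ?_
    have hf : f ∈ IntermediateField.adjoin K (Set.range x) := htop ▸ IntermediateField.mem_top
    rw [IntermediateField.mem_adjoin_iff_div] at hf
    obtain ⟨a, ha, b, hb, rfl⟩ := hf
    rw [← hrange] at ha hb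
    obtain ⟨a, rfl⟩ := ha
    obtain ⟨b, rfl⟩ := hb
    by_cases hb : b = 0
    · exact ⟨0, 1, by simp, by simp [hb]⟩
    · exact ⟨a, b, hb, div_mul_cancel₀ _ ((map_ne_zero_iff _ hj).2 hb)⟩
  refine h1.trans ?_
  refine Scheme.Hom.birationalOver (AffineSpace.SpecIso _ (.of K)).inv _ _ ?_
  rw [AffineSpace.SpecIso_inv_over]
  rfl

end Birational

/-! ### Towers of toric fibrations, built one step at a time. -/

section Towers

/-- The affine variety `Spec R` of a finitely generated domain over a field. -/
noncomputable def Variety.ofDomain (k R : Type u) [Field k] [CommRing R] [IsDomain R] [Algebra k R]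
    [Algebra.FiniteType k R] : Variety k where
  toScheme := Spec (.of R)
  str := Spec.map (CommRingCat.ofHom (algebraMap k R))
  isIntegral := inferInstance
  isSeparated := inferInstance
  locallyOfFiniteType := by
    rw [HasRingHomProperty.Spec_iff (P := @LocallyOfFiniteType)]
    exact (RingHom.finiteType_algebraMap (A := k) (B := R)).2 inferInstance
  quasiCompact := inferInstance

/-- Varieties that are the target of a tower of toric fibrations with rational source. -/
inductive Variety.HasToricTower {k : Type u} [Field k] : Variety k → Prop
  | base (X : Variety k) : IsRational X.str → X.HasToricTower
  | step (X Y : Variety k) (p : Y.toScheme.RationalMap X.toScheme) :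
      IsToricFibration p → Y.HasToricTower → X.HasToricTower

theorem Variety.HasToricTower.exists_sequence {k : Type u} [Field k] {Y : Variety k}
    (h : Y.HasToricTower) :
    ∃ (n : ℕ) (X : Fin (n + 1) → Variety k)
      (p : ∀ i : Fin n, (X i.succ).toScheme.RationalMap (X i.castSucc).toScheme),
      X 0 = Y ∧ (∀ i, IsToricFibration (p i)) ∧ IsRational (X (Fin.last n)).str := by
  induction h with
  | base X hX => exact ⟨0, fun _ => X, fun i => i.elim0, rfl, fun i => i.elim0, hX⟩
  | step X Y p hp _ ih =>
    obtain ⟨n, Z, q, rfl, hq, hr⟩ := ih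
    refine ⟨n + 1, Fin.cons X Z, Fin.cases p q, rfl, ?_, hr⟩
    intro i
    induction i using Fin.cases with
    | zero => exact hp
    | succ i => exact hq i

theorem Variety.HasToricTower.admits {k R : Type u} [Field k] [CommRing R] [IsDomain R]
    [Algebra k R] [Algebra.FiniteType k R] (h : (Variety.ofDomain k R).HasToricTower) :
    AdmitsToricRationalTower (Spec.map (CommRingCat.ofHom (algebraMap k R))) := by
  obtain ⟨n, X, p, h0, hp, hr⟩ := h.exists_sequence
  refine ⟨n, X, p, ?_, hp, hr⟩
  rw [h0]
  exact ⟨Iso.refl _, Category.id_comp _⟩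

end Towers

/-! ### Spreading out a torsor over the function field to a fibration of varieties. -/

section GenericFiber

theorem isGeometricallyRationalIrreducible_of_iso {K : Type u} [Field K] {F : Scheme.{u}}
    (s : F ⟶ Spec (CommRingCat.of K)) {B : Type u} [CommRing B] [Algebra K B]
    (e : F ≅ Spec (.of B)) (he : e.hom ≫ Spec.map (CommRingCat.ofHom (algebraMap K B)) = s)
    (hirr : IsDomain (AlgebraicClosure K ⊗[K] B))
    (hrat : IsRational (Spec.map (CommRingCat.ofHom
      (algebraMap (AlgebraicClosure K) (AlgebraicClosure K ⊗[K] B))))) :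
    IsGeometricallyRationalIrreducible s := by
  let c : Spec (CommRingCat.of (AlgebraicClosure K)) ⟶ Spec (CommRingCat.of K) :=
    Spec.map (CommRingCat.ofHom (algebraMap K (AlgebraicClosure K)))
  let T := AlgebraicClosure K ⊗[K] B
  have hpb : IsPullback
      (Spec.map (CommRingCat.ofHom (Algebra.TensorProduct.includeRight (R := K)
        (A := AlgebraicClosure K) (B := B)).toRingHom) ≫ e.inv)
      (Spec.map (CommRingCat.ofHom (algebraMap (AlgebraicClosure K) T))) s c := by
    have h1 := (isPullback_SpecMap_of_isPushout _ _ _ _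
      (CommRingCat.isPushout_tensorProduct K (AlgebraicClosure K) B)).flip
    have h2 : IsPullback e.inv (Spec.map (CommRingCat.ofHom (algebraMap K B))) s (𝟙 _) :=
      IsPullback.of_horiz_isIso ⟨by rw [Category.comp_id, ← he, Iso.inv_hom_id_assoc]⟩
    have h3 := h1.flip.paste_vert h2.flip
    rw [Category.comp_id] at h3
    exact h3.flip
  let i := hpb.isoPullback
  refine ⟨?_, ?_⟩
  · have : IrreducibleSpace (Spec (.of T)) := inferInstance
    exact Function.Surjective.irreducibleSpace (Scheme.homeoOfIso i).continuous
      (Scheme.homeoOfIso i).surjective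
  · obtain ⟨d, hd⟩ := hrat
    refine ⟨d, .trans ?_ hd⟩
    refine Scheme.Hom.birationalOver i.inv _ _ ?_
    exact hpb.isoPullback_inv_snd

/-- A finitely generated algebra over the fraction field of a domain has a finitely generated
model over the domain. -/
theorem exists_finiteType_model {R K B : Type u} [CommRing R] [IsDomain R] [Field K] [Algebra R K]
    [IsFractionRing R K] [CommRing B] [Algebra K B] [Algebra R B] [IsScalarTower R K B]
    [hB : Algebra.FiniteType K B] :
    ∃ S : Subalgebra R B, Algebra.FiniteType R S ∧
      ∀ b : B, ∃ r : R, r ≠ 0 ∧ r • b ∈ S := by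
  obtain ⟨s, hs⟩ := hB.out
  refine ⟨Algebra.adjoin R s, Subalgebra.fg_iff_finiteType _ |>.1 ⟨s, rfl⟩, fun b => ?_⟩
  have hb : b ∈ Algebra.adjoin K (s : Set B) := hs ▸ Algebra.mem_top
  induction hb using Algebra.adjoin_induction with
  | mem x hx => exact ⟨1, one_ne_zero, by simpa using Algebra.subset_adjoin hx⟩
  | algebraMap a =>
    obtain ⟨r, d, hd, rfl⟩ := IsFractionRing.div_surjective (A := R) a
    have hd0 : algebraMap R K d ≠ 0 :=
      (map_ne_zero_iff _ (IsFractionRing.injective R K)).2 (nonZeroDivisors.ne_zero hd)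
    refine ⟨d, nonZeroDivisors.ne_zero hd, ?_⟩
    rw [Algebra.smul_def, IsScalarTower.algebraMap_apply R K B, ← map_mul, mul_div_cancel₀ _ hd0,
      ← IsScalarTower.algebraMap_apply]
    exact Subalgebra.algebraMap_mem _ _
  | add x y _ _ hx hy =>
    obtain ⟨r, hr, hrx⟩ := hx
    obtain ⟨t, ht, hty⟩ := hy
    refine ⟨r * t, mul_ne_zero hr ht, ?_⟩
    rw [smul_add]
    refine add_mem ?_ ?_
    · rw [mul_comm, mul_smul]; exact Subalgebra.smul_mem _ hrx _
    · rw [mul_smul]; exact Subalgebra.smul_mem _ hty _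
  | mul x y _ _ hx hy =>
    obtain ⟨r, hr, hrx⟩ := hx
    obtain ⟨t, ht, hty⟩ := hy
    refine ⟨r * t, mul_ne_zero hr ht, ?_⟩
    rw [← smul_mul_smul_comm]
    exact mul_mem hrx hty

/-- The hypothesis `hS` makes `B` the localization of `S` at the nonzero elements of `R`, that is `S
⊗_R K`. -/
theorem isPullback_spec_fractionRing {R K B : Type u} [CommRing R] [IsDomain R] [Field K]
    [Algebra R K] [IsFractionRing R K] [CommRing B] [Algebra K B] [Algebra R B]
    [IsScalarTower R K B] (S : Subalgebra R B) (hS : ∀ b : B, ∃ r : R, r ≠ 0 ∧ r • b ∈ S) :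
    IsPullback (Spec.map (CommRingCat.ofHom S.val.toRingHom))
      (Spec.map (CommRingCat.ofHom (algebraMap K B)))
      (Spec.map (CommRingCat.ofHom (algebraMap R S)))
      (Spec.map (CommRingCat.ofHom (algebraMap R K))) := by
  have hu : ∀ r : R, r ≠ 0 → IsUnit (algebraMap R B r) := fun r hr => by
    rw [IsScalarTower.algebraMap_apply R K B]
    exact (IsUnit.mk0 _ ((map_ne_zero_iff _ (IsFractionRing.injective R K)).2 hr)).map _
  have : IsLocalization ((nonZeroDivisors R).map (algebraMap R S)) B := by
    constructor
    constructor
    · rintro ⟨_, r, hr, rfl⟩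
      exact hu r (nonZeroDivisors.ne_zero hr)
    · intro b
      obtain ⟨r, hr, hb⟩ := hS b
      refine ⟨⟨⟨_, hb⟩, ⟨_, r, mem_nonZeroDivisors_of_ne_zero hr, rfl⟩⟩, ?_⟩
      change b * algebraMap R B r = r • b
      rw [Algebra.smul_def, mul_comm]
    · intro x y h
      refine ⟨1, ?_⟩
      rw [Subtype.ext (show (x : B) = y from h)]
  refine isPullback_SpecMap_of_isPushout _ _ _ _
    (CommRingCat.isPushout_of_isLocalization (algebraMap R S) (algebraMap K B) ?_
      (nonZeroDivisors R))
  rw [← IsScalarTower.algebraMap_eq R K B]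
  rfl

/-- The function field of `Spec R`. -/
noncomputable abbrev specFunctionField (R : Type u) [CommRing R] [IsDomain R] : CommRingCat.{u} :=
  (Spec (.of R)).functionField

noncomputable instance (R : Type u) [CommRing R] [IsDomain R] : Algebra R (specFunctionField R) :=
  haveI : IsDomain (CommRingCat.of R) := inferInstanceAs (IsDomain R)
  AlgebraicGeometry.instAlgebraCarrierFunctionFieldSpec (.of R)

instance (R : Type u) [CommRing R] [IsDomain R] : IsFractionRing R (specFunctionField R) :=
  haveI : IsDomain (CommRingCat.of R) := inferInstanceAs (IsDomain R)
  functionField_isFractionRing_of_affine (.of R)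

theorem Spec.fromSpecStalk_genericPoint (R : Type u) [CommRing R] [IsDomain R] :
    (Spec (.of R)).fromSpecStalk (genericPoint (Spec (.of R))) =
      Spec.map (CommRingCat.ofHom (algebraMap R (specFunctionField R))) :=
  Spec.fromSpecStalk_eq' _ _

/-- The next variety is `Spec S` for a finitely generated `R`-model `S` of `B`, and its generic
fibre over `Spec R` is the torsor `Spec B` itself. The choice of `S` is internal to the proof, so
`next` has to supply a tower for every model. -/
theorem Variety.HasToricTower.of_torsor {k R : Type u} [Field k] [CommRing R] [IsDomain R]
    [Algebra k R] [Algebra.FiniteType k R]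
    {H B : Type u} [CommRing H] [HopfAlgebra (specFunctionField R) H]
    [CommRing B] [IsDomain B] [Algebra (specFunctionField R) B]
    [Algebra.FiniteType (specFunctionField R) B]
    (δ : B →ₐ[specFunctionField R] B ⊗[specFunctionField R] H)
    (hH : IsTorus (specFunctionField R) H) (hδ : IsTorsor δ)
    (hdom : IsDomain (AlgebraicClosure (specFunctionField R) ⊗[specFunctionField R] B))
    (hrat : IsRational (Spec.map (CommRingCat.ofHom
      (algebraMap (AlgebraicClosure (specFunctionField R))
        (AlgebraicClosure (specFunctionField R) ⊗[specFunctionField R] B)))))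
    [Algebra R B] [IsScalarTower R (specFunctionField R) B] [Algebra k B] [IsScalarTower k R B]
    (next : ∀ (S : Subalgebra R B) [Algebra.FiniteType k S],
      (∀ b : B, ∃ r : R, r ≠ 0 ∧ r • b ∈ S) → (Variety.ofDomain k S).HasToricTower) :
    (Variety.ofDomain k R).HasToricTower := by
  let K := specFunctionField R
  obtain ⟨S, hSft, hS⟩ := exists_finiteType_model (R := R) (K := K) (B := B)
  have hkS : Algebra.FiniteType k S := Algebra.FiniteType.trans (S := R) inferInstance hSft
  have hpb := isPullback_spec_fractionRing (K := K) S hS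
  let f : Spec (.of S) ⟶ Spec (.of R) := Spec.map (CommRingCat.ofHom (algebraMap R S))
  have hinj : Function.Injective (algebraMap R S) := by
    intro x y h
    have h1 : algebraMap R B x = algebraMap R B y := congrArg (fun s : S => (s : B)) h
    rw [IsScalarTower.algebraMap_apply R K B, IsScalarTower.algebraMap_apply R K B] at h1
    exact IsFractionRing.injective R K ((algebraMap K B).injective h1)
  have hdomf : IsDominant f := by
    constructor
    refine (PrimeSpectrum.denseRange_comap_iff_ker_le_nilRadical (algebraMap R S)).2 ?_
    rw [(RingHom.injective_iff_ker_eq_bot _).1 hinj]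
    exact bot_le
  -- A partial map coming from a morphism has domain `⊤`, which is a scheme isomorphic to the source
  -- but not the source itself; `topIso` accounts for the difference.
  have hpb' : IsPullback (Spec.map (CommRingCat.ofHom S.val.toRingHom) ≫
        (Spec (.of S)).topIso.inv)
      (Spec.map (CommRingCat.ofHom (algebraMap K B))) f.toPartialMap.hom
      ((Spec (.of R)).fromSpecStalk (genericPoint (Spec (.of R)))) := by
    rw [Spec.fromSpecStalk_genericPoint]
    have h2 : IsPullback (Spec (.of S)).topIso.inv f f.toPartialMap.hom (𝟙 _) :=
      IsPullback.of_horiz_isIso ⟨by simp⟩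
    have h3 := hpb.flip.paste_vert h2.flip
    rw [Category.comp_id] at h3
    exact h3.flip
  let e := hpb'.isoPullback.symm
  have he : e.hom ≫ Spec.map (CommRingCat.ofHom (algebraMap K B)) =
    genericFiberStr f.toPartialMap := hpb'.isoPullback_inv_snd
  have h1 : f.toPartialMap.toRationalMap.compHom (Spec.map (CommRingCat.ofHom (algebraMap k R))) =
      (Spec.map (CommRingCat.ofHom (algebraMap k S))).toRationalMap := by
    rw [← Scheme.RationalMap.compHom_toRationalMap, Scheme.Hom.toPartialMap_compHom]
    congr 2
    rw [← Spec.map_comp, ← CommRingCat.ofHom_comp, ← IsScalarTower.algebraMap_eq]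
  have h2 : f.toPartialMap.toRationalMap.IsDominant :=
    (Scheme.PartialMap.isDominant_toRationalMap_iff _).2 inferInstance
  have h3 : IsGeometricallyRationalIrreducible (genericFiberStr f.toPartialMap) :=
    isGeometricallyRationalIrreducible_of_iso _ e he hdom hrat
  have h4 : IsBirationalToTorusTorsor (genericFiberStr f.toPartialMap) :=
    ⟨H, _, _, B, _, _, δ, hH, hδ, Scheme.Hom.birationalOver e.hom _ _ he⟩
  exact .step (Variety.ofDomain k R) (Variety.ofDomain k S) f.toPartialMap.toRationalMap
    ⟨h1, h2, f.toPartialMap, rfl, h3, h4⟩ (next S hS)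

end GenericFiber

/-! ### Descent of injectivity and bijectivity along a field extension. -/

section BaseChange

variable {K L : Type*} [Field K] [Field L] [Algebra K L]

theorem IsBaseChange.injective_of_field {X A : Type*} [AddCommGroup X] [AddCommGroup A]
    [Module K X] [Module K A] [Module L A] [IsScalarTower K L A] {i : X →ₗ[K] A}
    (hi : IsBaseChange L i) : Function.Injective i := by
  intro x y h
  rw [← one_smul L (i x), ← one_smul L (i y), ← hi.equiv_tmul, ← hi.equiv_tmul] at h
  exact Module.FaithfullyFlat.tensorProduct_mk_injective (A := K) (B := L) X (hi.equiv.injective h)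

/-- A field extension is faithfully flat, and `f` is identified with the base change of `f₀`. -/
theorem IsBaseChange.bijective_descent {X Y A B : Type*} [AddCommGroup X] [AddCommGroup A]
    [Module K X] [Module K A] [Module L A] [IsScalarTower K L A]
    [AddCommGroup Y] [AddCommGroup B]
    [Module K Y] [Module K B] [Module L B] [IsScalarTower K L B]
    {i : X →ₗ[K] A} {j : Y →ₗ[K] B} (hi : IsBaseChange L i) (hj : IsBaseChange L j)
    (f₀ : X →ₗ[K] Y) (f : A →ₗ[L] B) (h : ∀ x, f (i x) = j (f₀ x)) (hf : Function.Bijective f) :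
    Function.Bijective f₀ := by
  rw [← Module.FaithfullyFlat.lTensor_bijective_iff_bijective K L]
  have : ⇑(f₀.lTensor L) = hj.equiv.symm ∘ f ∘ hi.equiv := by
    funext t
    induction t with
    | zero => simp
    | add x y hx hy => rw [map_add, hx, hy]; simp
    | tmul l x =>
      refine (LinearEquiv.eq_symm_apply _).2 ?_
      rw [LinearMap.lTensor_tmul, hj.equiv_tmul, Function.comp_apply, hi.equiv_tmul, map_smul,
        h]
  rw [this]
  exact hj.equiv.symm.bijective.comp (hf.comp hi.equiv.bijective)

variable {B H A A' : Type*} [CommRing B] [Algebra K B] [CommRing H] [Algebra K H]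
  [CommRing A] [Algebra K A] [Algebra L A] [IsScalarTower K L A]
  [CommRing A'] [Algebra K A'] [Algebra L A'] [IsScalarTower K L A']

variable (L) in
/-- The map induced on tensor products by two algebra maps from `K`-algebras to `L`-algebras. -/
noncomputable def tensorToTensor (i : B →ₐ[K] A) (j : H →ₐ[K] A') : B ⊗[K] H →ₐ[K] A ⊗[L] A' :=
  Algebra.TensorProduct.lift
    (((Algebra.TensorProduct.includeLeft : A →ₐ[L] A ⊗[L] A').restrictScalars K).comp i)
    (((Algebra.TensorProduct.includeRight : A' →ₐ[L] A ⊗[L] A').restrictScalars K).comp j)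
    (fun _ _ => Commute.all _ _)

@[simp]
theorem tensorToTensor_tmul (i : B →ₐ[K] A) (j : H →ₐ[K] A') (b : B) (h : H) :
    tensorToTensor L i j (b ⊗ₜ h) = i b ⊗ₜ j h := by
  simp [tensorToTensor]

theorem isBaseChange_tensorToTensor {i : B →ₐ[K] A} {j : H →ₐ[K] A'}
    (hi : IsBaseChange L i.toLinearMap) (hj : IsBaseChange L j.toLinearMap) :
    IsBaseChange L (tensorToTensor L i j).toLinearMap := by
  refine IsBaseChange.of_equiv
    (TensorProduct.AlgebraTensorModule.distribBaseChange K L B H ≪≫ₗ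
      TensorProduct.congr hi.equiv hj.equiv) fun x => ?_
  induction x with
  | zero => simp
  | add x y hx hy => rw [tmul_add, map_add, hx, hy, map_add]
  | tmul x y => simp [hi.equiv_tmul, hj.equiv_tmul]

theorem tensorToTensor_injective {i : B →ₐ[K] A} {j : H →ₐ[K] A'}
    (hi : IsBaseChange L i.toLinearMap) (hj : IsBaseChange L j.toLinearMap) :
    Function.Injective (tensorToTensor L i j) :=
  (isBaseChange_tensorToTensor hi hj).injective_of_field

end BaseChange

/-! ### Descent of Hopf algebra and comodule identities. -/

section HopfDescent

variable {K L : Type*} [Field K] [Field L] [Algebra K L]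
variable {B H A : Type*} [CommRing B] [Algebra K B] [CommRing H]
  [CommRing A] [HopfAlgebra L A] [Algebra K A] [IsScalarTower K L A]

/-- Both sides embed into `A ⊗ (A ⊗ A)` over `L`, where the identity is coassociativity of `A`.
Allowing `B` to differ from `H` covers the torsor as well as the torus. -/
theorem coassoc_descent [Algebra K H] {i : B →ₐ[K] A} {j : H →ₐ[K] A}
    (hi : IsBaseChange L i.toLinearMap) (hj : IsBaseChange L j.toLinearMap)
    (δ : B →ₐ[K] B ⊗[K] H) (Δ : H →ₐ[K] H ⊗[K] H)
    (hδ : ∀ b, tensorToTensor L i j (δ b) = Coalgebra.comul (R := L) (i b))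
    (hΔ : ∀ b, tensorToTensor L j j (Δ b) = Coalgebra.comul (R := L) (j b)) :
    ((Algebra.TensorProduct.assoc K K K B H H).toAlgHom.comp
      (Algebra.TensorProduct.map δ (AlgHom.id K H))).comp δ =
    (Algebra.TensorProduct.map (AlgHom.id K B) Δ).comp δ := by
  have hinj : Function.Injective (tensorToTensor L i (tensorToTensor L j j)) :=
    tensorToTensor_injective hi (isBaseChange_tensorToTensor hj hj)
  have h1 : ∀ t, tensorToTensor L i (tensorToTensor L j j)
      (Algebra.TensorProduct.assoc K K K B H H t) =
      TensorProduct.assoc L A A A (tensorToTensor L (tensorToTensor L i j) j t) := by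
    intro t
    induction t with
    | zero => simp
    | add x y hx hy => simp only [map_add, hx, hy]
    | tmul x h =>
      induction x with
      | zero => simp
      | add x y hx hy => simp only [add_tmul, map_add, hx, hy]
      | tmul b h' => simp
  have h2 : ∀ t, tensorToTensor L (tensorToTensor L i j) j
      (Algebra.TensorProduct.map δ (AlgHom.id K H) t) =
      (Coalgebra.comul (R := L) (A := A)).rTensor A (tensorToTensor L i j t) := by
    intro t
    induction t with
    | zero => simp
    | add x y hx hy => simp only [map_add, hx, hy]
    | tmul b h => simp [hδ]
  have h3 : ∀ t, tensorToTensor L i (tensorToTensor L j j)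
      (Algebra.TensorProduct.map (AlgHom.id K B) Δ t) =
      (Coalgebra.comul (R := L) (A := A)).lTensor A (tensorToTensor L i j t) := by
    intro t
    induction t with
    | zero => simp
    | add x y hx hy => simp only [map_add, hx, hy]
    | tmul b h => simp [hΔ]
  refine AlgHom.ext fun b => hinj ?_
  change tensorToTensor L i (tensorToTensor L j j) (Algebra.TensorProduct.assoc K K K B H H
    (Algebra.TensorProduct.map δ (AlgHom.id K H) (δ b))) = tensorToTensor L i
      (tensorToTensor L j j) (Algebra.TensorProduct.map (AlgHom.id K B) Δ (δ b))
  rw [h1, h2, h3, hδ]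
  exact Coalgebra.coassoc_apply (i b)

theorem lTensor_counit_descent [Algebra K H] {i : B →ₐ[K] A} {j : H →ₐ[K] A}
    (hi : IsBaseChange L i.toLinearMap) (δ : B →ₐ[K] B ⊗[K] H) (ε : H →ₐ[K] K)
    (hδ : ∀ b, tensorToTensor L i j (δ b) = Coalgebra.comul (R := L) (i b))
    (hε : ∀ b, algebraMap K L (ε b) = Coalgebra.counit (R := L) (j b)) (b : B) :
    Algebra.TensorProduct.rid K K B (Algebra.TensorProduct.map (AlgHom.id K B) ε (δ b)) = b := by
  have h1 : ∀ t, i (Algebra.TensorProduct.rid K K B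
      (Algebra.TensorProduct.map (AlgHom.id K B) ε t)) =
      TensorProduct.rid L A ((Coalgebra.counit (R := L) (A := A)).lTensor A
        (tensorToTensor L i j t)) := by
    intro t
    induction t with
    | zero => simp
    | add x y hx hy => simp only [map_add, hx, hy]
    | tmul b h => simp [← hε]
  refine hi.injective_of_field ?_
  change i _ = i b
  rw [h1, hδ, Coalgebra.lTensor_counit_comul]
  simp

theorem rTensor_counit_descent [Algebra K H] {j : H →ₐ[K] A}
    (hj : IsBaseChange L j.toLinearMap) (Δ : H →ₐ[K] H ⊗[K] H) (ε : H →ₐ[K] K)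
    (hΔ : ∀ b, tensorToTensor L j j (Δ b) = Coalgebra.comul (R := L) (j b))
    (hε : ∀ b, algebraMap K L (ε b) = Coalgebra.counit (R := L) (j b)) (b : H) :
    Algebra.TensorProduct.lid K H (Algebra.TensorProduct.map ε (AlgHom.id K H) (Δ b)) = b := by
  have h1 : ∀ t, j (Algebra.TensorProduct.lid K H
      (Algebra.TensorProduct.map ε (AlgHom.id K H) t)) =
      TensorProduct.lid L A ((Coalgebra.counit (R := L) (A := A)).rTensor A
        (tensorToTensor L j j t)) := by
    intro t
    induction t with
    | zero => simp
    | add x y hx hy => simp only [map_add, hx, hy]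
    | tmul b h => simp [← hε]
  refine hj.injective_of_field ?_
  change j _ = j b
  rw [h1, hΔ, Coalgebra.rTensor_counit_comul]
  simp

/-- A `K`-form of a commutative Hopf algebra over `L`, stable under the structure maps, is a Hopf
algebra over `K`. -/
@[reducible]
noncomputable def HopfAlgebra.descent [Algebra K H] {j : H →ₐ[K] A}
    (hj : IsBaseChange L j.toLinearMap) (Δ : H →ₐ[K] H ⊗[K] H) (ε : H →ₐ[K] K) (S : H →ₗ[K] H)
    (hΔ : ∀ b, tensorToTensor L j j (Δ b) = Coalgebra.comul (R := L) (j b))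
    (hε : ∀ b, algebraMap K L (ε b) = Coalgebra.counit (R := L) (j b))
    (hS : ∀ b, j (S b) = HopfAlgebra.antipode L (j b)) : HopfAlgebra K H :=
  { Bialgebra.ofAlgHom Δ ε (coassoc_descent hj hj Δ Δ hΔ hΔ)
      (AlgHom.ext fun b => (AlgEquiv.eq_symm_apply _).2 (rTensor_counit_descent hj Δ ε hΔ hε b))
      (AlgHom.ext fun b => (AlgEquiv.eq_symm_apply _).2
        (lTensor_counit_descent hj Δ ε hΔ hε b)) with
    antipode := S
    mul_antipode_rTensor_comul := by
      have h1 : ∀ t, j (LinearMap.mul' K H (S.rTensor H t)) =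
          LinearMap.mul' L A ((HopfAlgebra.antipode L).rTensor A (tensorToTensor L j j t)) := by
        intro t
        induction t with
        | zero => simp
        | add x y hx hy => simp only [map_add, hx, hy]
        | tmul b h => simp [hS]
      refine LinearMap.ext fun b => hj.injective_of_field ?_
      change j (LinearMap.mul' K H (S.rTensor H (Δ b))) = j (algebraMap K H (ε b))
      rw [h1, hΔ, HopfAlgebra.mul_antipode_rTensor_comul_apply, ← hε, AlgHom.commutes,
        ← IsScalarTower.algebraMap_apply]
    mul_antipode_lTensor_comul := by
      have h1 : ∀ t, j (LinearMap.mul' K H (S.lTensor H t)) =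
          LinearMap.mul' L A ((HopfAlgebra.antipode L).lTensor A (tensorToTensor L j j t)) := by
        intro t
        induction t with
        | zero => simp
        | add x y hx hy => simp only [map_add, hx, hy]
        | tmul b h => simp [hS]
      refine LinearMap.ext fun b => hj.injective_of_field ?_
      change j (LinearMap.mul' K H (S.lTensor H (Δ b))) = j (algebraMap K H (ε b))
      rw [h1, hΔ, HopfAlgebra.mul_antipode_lTensor_comul_apply, ← hε, AlgHom.commutes,
        ← IsScalarTower.algebraMap_apply] }

end HopfDescent

/-! ### Galois descent for semilinear actions of a finite group. -/

section GaloisDescent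

variable {K L G : Type*} [Field K] [Field L] [Algebra K L] [Group G] [Fintype G]

/-- By Dedekind's independence of characters, no nonzero functional on `L^G` kills every vector `(σ
g a)_g`. These vectors therefore span, and the family expresses the basis vector at `1` through
them. It isolates a single group element in a sum over `G`, which yields explicit descent formulas.
-/
theorem exists_dual_family (σ : G →* (L ≃ₐ[K] L)) (hσ : Function.Injective σ) :
    ∃ (n : ℕ) (a b : Fin n → L), (∑ j, b j * a j = 1) ∧
      ∀ g ≠ 1, ∑ j, b j * σ g (a j) = 0 := by
  classical
  let v : L → G → L := fun a g => σ g a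
  have htop : Submodule.span L (Set.range v) = ⊤ := by
    by_contra hne
    obtain ⟨f, hf0, hf⟩ := Submodule.exists_le_ker_of_lt_top _ (lt_top_iff_ne_top.2 hne)
    apply hf0
    let m : G → (L →* L) := fun g => (σ g : L →* L)
    have hm : Function.Injective m := by
      intro g h hgh
      exact hσ (AlgEquiv.ext fun x => DFunLike.congr_fun hgh x)
    have hli := (linearIndependent_monoidHom L L).comp m hm
    rw [Fintype.linearIndependent_iff] at hli
    have key := hli (fun g => f (Pi.single g 1)) (by
      funext a
      have h1 : f (v a) = 0 := hf (Submodule.subset_span ⟨a, rfl⟩)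
      have h2 : v a = ∑ g, σ g a • (Pi.single g 1 : G → L) := by
        funext g
        simp [v, Finset.sum_apply, Pi.single_apply]
      rw [h2, map_sum] at h1
      simpa [m, mul_comm] using h1)
    exact LinearMap.pi_ext' fun g => LinearMap.ext_ring (by simpa using key g)
  have hmem : (Pi.single 1 1 : G → L) ∈ Submodule.span L (Set.range v) := htop ▸ trivial
  obtain ⟨n, b, w, hw⟩ := Submodule.mem_span_set'.1 hmem
  choose a ha using fun j => (w j).2
  have hsum : ∀ g, ∑ j, b j * σ g (a j) = (Pi.single 1 1 : G → L) g := by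
    intro g
    rw [← hw, Finset.sum_apply]
    refine Finset.sum_congr rfl fun j _ => ?_
    rw [Pi.smul_apply, ← ha j]
    rfl
  refine ⟨n, a, b, by simpa using hsum 1, fun g hg => ?_⟩
  rw [hsum, Pi.single_eq_of_ne hg]

/-- A semilinear action of a finite group of field automorphisms. -/
structure IsSemilinear {X : Type*} [AddCommGroup X] [Module K X] [Module L X]
    (σ : G →* (L ≃ₐ[K] L)) (τ : Representation K G X) : Prop where
  map_smul : ∀ g l x, τ g (l • x) = σ g l • τ g x

variable {X : Type*} [AddCommGroup X] [Module K X] [Module L X] [IsScalarTower K L X]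

theorem Representation.apply_sum_apply (τ : Representation K G X) (h : G) (x : X) :
    τ h (∑ g, τ g x) = ∑ g, τ g x := by
  rw [map_sum, ← Equiv.sum_comp (Equiv.mulLeft h) (fun g => τ g x)]
  simp

omit [IsScalarTower K L X] in
theorem IsSemilinear.sum_smul_sum {σ : G →* (L ≃ₐ[K] L)} {τ : Representation K G X}
    (hτ : IsSemilinear σ τ) {n : ℕ} {a b : Fin n → L} (h1 : ∑ j, b j * a j = 1)
    (h2 : ∀ g ≠ 1, ∑ j, b j * σ g (a j) = 0) (x : X) :
    ∑ j, b j • ∑ g, τ g (a j • x) = x := by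
  have : ∀ g, ∑ j, b j • τ g (a j • x) = (∑ j, b j * σ g (a j)) • τ g x := fun g => by
    simp only [hτ.map_smul, smul_smul, Finset.sum_smul]
  simp only [Finset.smul_sum]
  rw [Finset.sum_comm]
  simp only [this]
  rw [Finset.sum_eq_single 1]
  · simp [h1]
  · intro g _ hg
    rw [h2 g hg, zero_smul]
  · simp

/-- Galois descent for vector spaces. -/
theorem IsSemilinear.isBaseChange {σ : G →* (L ≃ₐ[K] L)} {τ : Representation K G X}
    (hτ : IsSemilinear σ τ) (hσ : Function.Injective σ)
    (hfix : ∀ l : L, (∀ g, σ g l = l) → ∃ r, algebraMap K L r = l)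
    {X₀ : Type*} [AddCommGroup X₀] [Module K X₀] (i : X₀ →ₗ[K] X) (hi : Function.Injective i)
    (hrange : ∀ x, (∃ y, i y = x) ↔ ∀ g, τ g x = x) : IsBaseChange L i := by
  obtain ⟨n, a, b, h1, h2⟩ := exists_dual_family σ hσ
  have hT : ∀ x, ∃ y, i y = ∑ g, τ g x := fun x => (hrange _).2 fun h => τ.apply_sum_apply h x
  choose T hTi using hT
  have hTadd : ∀ x y, T (x + y) = T x + T y := fun x y => hi (by
    simp only [map_add, hTi, Finset.sum_add_distrib])
  have hfixi : ∀ y g, τ g (i y) = i y := fun y => (hrange _).1 ⟨y, rfl⟩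
  have htr : ∀ l : L, ∃ r, algebraMap K L r = ∑ g, σ g l := fun l => hfix _ fun h => by
    rw [map_sum, ← Equiv.sum_comp (Equiv.mulLeft h) (fun g => σ g l)]
    simp
  choose tr htr using htr
  have hTsmul : ∀ l y, T (l • i y) = tr l • y := fun l y => hi (by
    rw [hTi, i.map_smul, ← algebraMap_smul L (tr l) (i y), htr, Finset.sum_smul]
    simp only [hτ.map_smul, hfixi])
  -- The families `a` and `b` are dual for the trace form.
  have hdual : ∀ l, ∑ j, tr (a j * l) • b j = l := by
    intro l
    have h3 : ∀ g, ∑ j, σ g (a j * l) * b j = (∑ j, b j * σ g (a j)) * σ g l := fun g => by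
      rw [Finset.sum_mul]
      exact Finset.sum_congr rfl fun j _ => by rw [map_mul]; ring
    simp only [Algebra.smul_def, htr, Finset.sum_mul]
    rw [Finset.sum_comm]
    simp only [h3]
    rw [Finset.sum_eq_single 1]
    · simp [h1]
    · intro g _ hg
      rw [h2 g hg, zero_mul]
    · simp
  let φ : L ⊗[K] X₀ →ₗ[L] X := i.liftBaseChange L
  have hφ : ∀ l y, φ (l ⊗ₜ y) = l • i y := fun l y => by simp [φ]
  -- The dual family writes `x` as the combination of the traces of `a j • x` with coefficients `b
  -- j`; this gives the explicit inverse of `φ`.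
  let ψ : X → L ⊗[K] X₀ := fun x => ∑ j, b j ⊗ₜ T (a j • x)
  have hψφ : ∀ t, ψ (φ t) = t := by
    intro t
    induction t with
    | zero =>
      have hT0 : T 0 = 0 := by simpa using hTadd 0 0
      simp [ψ, hT0]
    | add x y hx hy =>
      conv_rhs => rw [← hx, ← hy]
      simp only [ψ, map_add, smul_add, hTadd, tmul_add, Finset.sum_add_distrib]
    | tmul l y =>
      simp only [ψ, hφ, smul_smul, hTsmul]
      simp only [← smul_tmul, ← sum_tmul, hdual]
  have hφψ : ∀ x, φ (ψ x) = x := fun x => by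
    simp only [ψ, map_sum, hφ, hTi]
    exact hτ.sum_smul_sum h1 h2 x
  exact IsBaseChange.of_equiv (LinearEquiv.ofBijective φ
    ⟨Function.LeftInverse.injective hψφ, Function.RightInverse.surjective hφψ⟩) fun x =>
      (hφ 1 x).trans (one_smul _ _)

end GaloisDescent

/-! ### Monomial semilinear actions on group algebras and their fixed algebras. -/

section TwistedGroupAlgebra

variable {K L G : Type*} [Field K] [Field L] [Algebra K L] [Group G]

/-- A semilinear action of `G` on the group algebra `L[M]` permuting the monomials up to
scalars. -/
structure MonomialAction (σ : G →* (L ≃ₐ[K] L)) (M : Type*) [AddCommGroup M] where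
  /-- The action on exponents. -/
  perm : G →* AddMonoid.End M
  /-- The scalars. -/
  coeff : G → Multiplicative M →* L
  coeff_one : ∀ m, coeff 1 m = 1
  -- This cocycle identity is what makes the maps on monomials compose as a group action.
  coeff_mul : ∀ g h m, coeff (g * h) (.ofAdd m) =
    coeff g (.ofAdd (perm h m)) * σ g (coeff h (.ofAdd m))

namespace MonomialAction

variable {σ : G →* (L ≃ₐ[K] L)} {M : Type*} [AddCommGroup M] (w : MonomialAction σ M)

/-- The action with the same permutation of exponents and trivial scalars. -/
def untwist : MonomialAction σ M where
  perm := w.perm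
  coeff _ := 1
  coeff_one _ := rfl
  coeff_mul g h m := by simp

/-- The action of a group element on the group algebra. -/
noncomputable def act (g : G) : AddMonoidAlgebra L M →ₐ[K] AddMonoidAlgebra L M :=
  AddMonoidAlgebra.liftNCAlgHom
    ((AddMonoidAlgebra.singleZeroAlgHom : L →ₐ[K] AddMonoidAlgebra L M).comp (σ g : L →ₐ[K] L))
    { toFun := fun m => AddMonoidAlgebra.single (w.perm g m.toAdd) (w.coeff g m)
      map_one' := by simp [AddMonoidAlgebra.one_def]
      map_mul' := fun m n => by simp [AddMonoidAlgebra.single_mul_single] }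
    (fun _ _ => Commute.all _ _)

@[simp]
theorem act_single (g : G) (m : M) (a : L) :
    w.act g (AddMonoidAlgebra.single m a) =
      AddMonoidAlgebra.single (w.perm g m) (σ g a * w.coeff g (.ofAdd m)) := by
  simp [act, AddMonoidAlgebra.single_mul_single]

theorem act_one (f : AddMonoidAlgebra L M) : w.act 1 f = f := by
  induction f using AddMonoidAlgebra.induction_linear with
  | zero => simp
  | add f g hf hg => rw [map_add, hf, hg]
  | single m a => simp [w.coeff_one]

theorem act_mul (g h : G) (f : AddMonoidAlgebra L M) : w.act (g * h) f = w.act g (w.act h f) := by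
  induction f using AddMonoidAlgebra.induction_linear with
  | zero => simp
  | add f g hf hg => simp only [map_add, hf, hg]
  | single m a =>
    simp only [act_single, map_mul, AlgEquiv.mul_apply, AddMonoid.End.coe_mul, Function.comp_apply, w.coeff_mul]
    congr 1
    ring

/-- The action on the group algebra as a representation over the small field. -/
noncomputable def rep : Representation K G (AddMonoidAlgebra L M) where
  toFun g := (w.act g).toLinearMap
  map_one' := LinearMap.ext w.act_one
  map_mul' g h := LinearMap.ext (w.act_mul g h)

@[simp]
theorem rep_apply (g : G) (f : AddMonoidAlgebra L M) : w.rep g f = w.act g f := rfl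

theorem act_smul (g : G) (l : L) (f : AddMonoidAlgebra L M) :
    w.act g (l • f) = σ g l • w.act g f := by
  induction f using AddMonoidAlgebra.induction_linear with
  | zero => simp
  | add f g hf hg => simp only [map_add, smul_add, hf, hg]
  | single m a => simp [mul_assoc]

theorem isSemilinear_rep [Fintype G] : IsSemilinear σ w.rep := ⟨w.act_smul⟩

/-- The fixed subalgebra. -/
noncomputable def fixed : Subalgebra K (AddMonoidAlgebra L M) :=
  ⨅ g, AlgHom.equalizer (w.act g) (AlgHom.id K _)

theorem mem_fixed {f : AddMonoidAlgebra L M} : f ∈ w.fixed ↔ ∀ g, w.act g f = f := by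
  simp [fixed, Algebra.mem_iInf, AlgHom.mem_equalizer]

variable [Fintype G]

theorem isBaseChange (hσ : Function.Injective σ)
    (hfix : ∀ l : L, (∀ g, σ g l = l) → ∃ r, algebraMap K L r = l) :
    IsBaseChange L w.fixed.val.toLinearMap := by
  refine w.isSemilinear_rep.isBaseChange hσ hfix _ Subtype.val_injective fun x => ?_
  simp only [rep_apply]
  rw [← mem_fixed]
  exact ⟨fun ⟨y, hy⟩ => hy ▸ y.2, fun h => ⟨⟨x, h⟩, rfl⟩⟩

/-- The averaging map onto the fixed subalgebra. -/
noncomputable def trace (f : AddMonoidAlgebra L M) : w.fixed :=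
  ⟨∑ g, w.act g f, w.mem_fixed.2 fun h => w.rep.apply_sum_apply h f⟩

omit [Fintype G] in
-- Monomials are grouplike, so the scalar picked up by a monomial can be put entirely on the left
-- factor. The right factor then carries the action without scalars, and this is why the torus
-- coacting on `w.fixed` is `w.untwist.fixed`.
theorem comul_act_single (g : G) (m : M) (l : L) :
    Coalgebra.comul (R := L) (w.act g (AddMonoidAlgebra.single m l)) =
      σ g l • (w.act g (AddMonoidAlgebra.single m 1) ⊗ₜ[L]
        w.untwist.act g (AddMonoidAlgebra.single m 1)) := by
  have h : ∀ (p : M) (a : L), AddMonoidAlgebra.single p a =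
      a • (AddMonoidAlgebra.single p 1 : AddMonoidAlgebra L M) := fun p a => by simp
  simp only [act_single, AddMonoidAlgebra.comul_single, CommSemiring.comul_apply, map_tmul,
    AddMonoidAlgebra.lsingle_apply, map_one, one_mul, untwist, MonoidHom.one_apply]
  rw [h _ (w.coeff _ _), h _ (σ g l * _), tmul_smul, ← smul_tmul', smul_smul]

/-- Every fixed element is a trace, so by additivity only traces of monomials need checking. The
dual family expands each translate of a monomial in fixed elements on both tensor factors, and the
resulting coefficients are traces from `L`, hence lie in `K`. -/
theorem comul_mem_range (hσ : Function.Injective σ)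
    (hfix : ∀ l : L, (∀ g, σ g l = l) → ∃ r, algebraMap K L r = l) (x : w.fixed) :
    Coalgebra.comul (R := L) (x : AddMonoidAlgebra L M) ∈
      (tensorToTensor L w.fixed.val w.untwist.fixed.val).range := by
  obtain ⟨n, a, b, h1, h2⟩ := exists_dual_family σ hσ
  have htr : ∀ l : L, ∃ r, algebraMap K L r = ∑ g, σ g l := fun l => hfix _ fun h => by
    rw [map_sum, ← Equiv.sum_comp (Equiv.mulLeft h) (fun g => σ g l)]
    simp
  have key : ∀ f, Coalgebra.comul (R := L) (w.trace f : AddMonoidAlgebra L M) ∈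
      (tensorToTensor L w.fixed.val w.untwist.fixed.val).range := by
    intro f
    induction f using AddMonoidAlgebra.induction_linear with
    | zero => simp [trace]
    | add f g hf hg =>
      have : (w.trace (f + g) : AddMonoidAlgebra L M) = w.trace f + w.trace g := by
        simp [trace, Finset.sum_add_distrib]
      rw [this, map_add]
      exact add_mem hf hg
    | single m l =>
      have hdec : ∀ (v : MonomialAction σ M) (g : G), v.act g (AddMonoidAlgebra.single m 1) =
          ∑ j, σ g (b j) • (v.trace (a j • AddMonoidAlgebra.single m 1) :
            AddMonoidAlgebra L M) := by
        intro v g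
        have h3 := v.isSemilinear_rep.sum_smul_sum h1 h2 (AddMonoidAlgebra.single m 1)
        conv_lhs => rw [← h3]
        rw [map_sum]
        refine Finset.sum_congr rfl fun j _ => ?_
        rw [v.act_smul]
        congr 1
        exact v.rep.apply_sum_apply g _
      have h4 : Coalgebra.comul (R := L)
          (w.trace (AddMonoidAlgebra.single m l) : AddMonoidAlgebra L M) =
          ∑ j, ∑ j', (∑ g, σ g (l * (b j * b j'))) •
            ((w.trace (a j • AddMonoidAlgebra.single m 1) : AddMonoidAlgebra L M) ⊗ₜ[L]
              (w.untwist.trace (a j' • AddMonoidAlgebra.single m 1) : AddMonoidAlgebra L M)) := by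
        have h5 : (w.trace (AddMonoidAlgebra.single m l) : AddMonoidAlgebra L M) =
          ∑ g, w.act g (AddMonoidAlgebra.single m l) := rfl
        rw [h5, map_sum]
        simp only [comul_act_single, hdec, sum_tmul, tmul_sum, ← smul_tmul', tmul_smul,
          Finset.smul_sum, Finset.sum_smul, smul_smul, map_mul]
        rw [Finset.sum_comm]
        conv_rhs => rw [Finset.sum_comm]
        refine Finset.sum_congr rfl fun j _ => ?_
        rw [Finset.sum_comm]
        refine Finset.sum_congr rfl fun j' _ => Finset.sum_congr rfl fun g _ => ?_
        congr 2
        ring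
      rw [h4]
      refine sum_mem fun j _ => sum_mem fun j' _ => ?_
      obtain ⟨r, hr⟩ := htr (l * (b j * b j'))
      rw [← hr, algebraMap_smul]
      refine Subalgebra.smul_mem _ ?_ _
      exact ⟨w.trace (a j • AddMonoidAlgebra.single m 1) ⊗ₜ
        w.untwist.trace (a j' • AddMonoidAlgebra.single m 1), by simp⟩
  -- Some `a j` has nonzero trace, and rescaling it within `K` gives an element of trace one. Then
  -- `x` is the trace of `l • x`.
  obtain ⟨l, hl⟩ : ∃ l : L, ∑ g, σ g l = 1 := by
    have h3 : ∑ j, b j * ∑ g, σ g (a j) = 1 := by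
      simp only [Finset.mul_sum]
      rw [Finset.sum_comm, Finset.sum_eq_single 1 (fun g _ hg => h2 g hg) (by simp)]
      simpa using h1
    obtain ⟨j, hj⟩ : ∃ j, ∑ g, σ g (a j) ≠ 0 := by
      by_contra! h
      simp [h] at h3
    obtain ⟨r, hr⟩ := htr (a j)
    rw [← hr] at hj
    refine ⟨algebraMap K L r⁻¹ * a j, ?_⟩
    simp only [map_mul, AlgEquiv.commutes]
    rw [← Finset.mul_sum, ← hr, ← map_mul, inv_mul_cancel₀ (by simpa using hj), map_one]
  have h6 : (w.trace (l • x.1) : AddMonoidAlgebra L M) = x := by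
    have h7 := w.mem_fixed.1 x.2
    change ∑ g, w.act g (l • x.1) = x
    simp only [w.act_smul, h7, ← Finset.sum_smul, hl, one_smul]
  rw [← h6]
  exact key _

end MonomialAction

end TwistedGroupAlgebra

/-! ### Split tori: scalar extension and the self-torsor property. -/

section SplitTorus

variable {L C : Type*} [Field L] [Field C] [Algebra L C]
  {M N : Type*} [AddCommGroup M] [AddCommGroup N]

variable (L C) in
/-- The extension of scalars of a group algebra along an isomorphism of groups. -/
noncomputable def groupAlgebraBaseChange (e : M ≃+ N) :
    AddMonoidAlgebra L M →ₐ[L] AddMonoidAlgebra C N :=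
  AddMonoidAlgebra.lift L (AddMonoidAlgebra C N) M
    { toFun := fun m => AddMonoidAlgebra.single (e m.toAdd) 1
      map_one' := by simp [AddMonoidAlgebra.one_def]
      map_mul' := fun m n => by simp [AddMonoidAlgebra.single_mul_single] }

@[simp]
theorem groupAlgebraBaseChange_single (e : M ≃+ N) (m : M) (a : L) :
    groupAlgebraBaseChange L C e (AddMonoidAlgebra.single m a) =
      AddMonoidAlgebra.single (e m) (algebraMap L C a) := by
  simp [groupAlgebraBaseChange, Algebra.smul_def]

theorem isBaseChange_groupAlgebraBaseChange (e : M ≃+ N) :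
    IsBaseChange C (groupAlgebraBaseChange L C e).toLinearMap := by
  refine IsBaseChange.of_equiv ((AddMonoidAlgebra.scalarTensorEquiv L C).toLinearEquiv ≪≫ₗ
    (AddMonoidAlgebra.domCongr C C e).toLinearEquiv) fun x => ?_
  induction x using AddMonoidAlgebra.induction_linear with
  | zero => simp
  | add f g hf hg => rw [tmul_add, map_add, hf, hg, map_add]
  | single m a => simp [Algebra.ofId_apply]

theorem counit_groupAlgebraBaseChange (e : M ≃+ N) (f : AddMonoidAlgebra L M) :
    Coalgebra.counit (R := C) (groupAlgebraBaseChange L C e f) =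
      algebraMap L C (Coalgebra.counit (R := L) f) := by
  induction f using AddMonoidAlgebra.induction_linear with
  | zero => simp
  | add f g hf hg => simp only [map_add, hf, hg]
  | single m a => simp

theorem comul_groupAlgebraBaseChange (e : M ≃+ N) (f : AddMonoidAlgebra L M) :
    Coalgebra.comul (R := C) (groupAlgebraBaseChange L C e f) =
      tensorToTensor C (groupAlgebraBaseChange L C e) (groupAlgebraBaseChange L C e)
        (Coalgebra.comul (R := L) f) := by
  induction f using AddMonoidAlgebra.induction_linear with
  | zero => simp
  | add f g hf hg => simp only [map_add, hf, hg]
  | single m a => simp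

variable (L M) in
/-- The algebra map `x ↦ (S ⊗ 1) (Δ x)`. -/
noncomputable def antipodeComul :
    AddMonoidAlgebra L M →ₐ[L] AddMonoidAlgebra L M ⊗[L] AddMonoidAlgebra L M :=
  AddMonoidAlgebra.lift L (AddMonoidAlgebra L M ⊗[L] AddMonoidAlgebra L M) M
    { toFun := fun m => AddMonoidAlgebra.single (-m.toAdd) 1 ⊗ₜ
        AddMonoidAlgebra.single m.toAdd 1
      map_one' := by simp [AddMonoidAlgebra.one_def, Algebra.TensorProduct.one_def]
      map_mul' := fun m n => by
        simp [AddMonoidAlgebra.single_mul_single, add_comm] }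

@[simp]
theorem antipodeComul_single (m : M) : antipodeComul L M (AddMonoidAlgebra.single m 1) =
    AddMonoidAlgebra.single (-m) 1 ⊗ₜ AddMonoidAlgebra.single m 1 := by
  simp [antipodeComul]

/-- The algebra map `a ⊗ b ↦ a ⊗ 1 * Δ b` is bijective: a torus is a torsor under itself. -/
theorem bijective_lift_comul :
    Function.Bijective (Algebra.TensorProduct.lift
      (Algebra.TensorProduct.includeLeft :
        AddMonoidAlgebra L M →ₐ[L] AddMonoidAlgebra L M ⊗[L] AddMonoidAlgebra L M)
      (Bialgebra.comulAlgHom L (AddMonoidAlgebra L M)) (fun _ _ => Commute.all _ _)) := by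
  set F := Algebra.TensorProduct.lift
      (Algebra.TensorProduct.includeLeft :
        AddMonoidAlgebra L M →ₐ[L] AddMonoidAlgebra L M ⊗[L] AddMonoidAlgebra L M)
      (Bialgebra.comulAlgHom L (AddMonoidAlgebra L M)) (fun _ _ => Commute.all _ _) with hF
  -- The inverse corresponds to `(p, q) ↦ (p, p⁻¹ q)`.
  let E := Algebra.TensorProduct.lift
    (Algebra.TensorProduct.includeLeft :
        AddMonoidAlgebra L M →ₐ[L] AddMonoidAlgebra L M ⊗[L] AddMonoidAlgebra L M)
    (antipodeComul L M) (fun _ _ => Commute.all _ _)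
  have h1 : E.comp F = AlgHom.id L _ := by
    refine Algebra.TensorProduct.ext (by ext; simp [E, hF])
      (AddMonoidAlgebra.algHom_ext (fun m => ?_) (Subsingleton.elim _ _))
    simp [E, hF, AddMonoidAlgebra.single_mul_single, AddMonoidAlgebra.one_def]
  have h2 : F.comp E = AlgHom.id L _ := by
    refine Algebra.TensorProduct.ext (by ext; simp [E, hF])
      (AddMonoidAlgebra.algHom_ext (fun m => ?_) (Subsingleton.elim _ _))
    simp [E, hF, AddMonoidAlgebra.single_mul_single, AddMonoidAlgebra.one_def]
  exact Function.bijective_iff_has_inverse.2 ⟨E, DFunLike.congr_fun h1, DFunLike.congr_fun h2⟩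

end SplitTorus

/-! ### The descended coaction and the Hopf algebra of the twisted torus. -/

section Torsor

namespace MonomialAction

variable {K L G : Type*} [Field K] [Field L] [Algebra K L] [Group G] [Fintype G]
  {σ : G →* (L ≃ₐ[K] L)} {M : Type*} [AddCommGroup M] (w : MonomialAction σ M)
  (hσ : Function.Injective σ)
  (hfix : ∀ l : L, (∀ g, σ g l = l) → ∃ r, algebraMap K L r = l)

include hσ hfix

theorem tensor_injective : Function.Injective
    (tensorToTensor L w.fixed.val w.untwist.fixed.val) :=
  tensorToTensor_injective (w.isBaseChange hσ hfix) (w.untwist.isBaseChange hσ hfix)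

/-- The coaction on the twisted form. -/
noncomputable def coaction : w.fixed →ₐ[K] w.fixed ⊗[K] w.untwist.fixed :=
  (AlgEquiv.ofInjective _ (w.tensor_injective hσ hfix)).symm.toAlgHom.comp
    (AlgHom.codRestrict (((Bialgebra.comulAlgHom L (AddMonoidAlgebra L M)).restrictScalars K).comp
      w.fixed.val) _ (w.comul_mem_range hσ hfix))

theorem tensorToTensor_coaction (b : w.fixed) :
    tensorToTensor L w.fixed.val w.untwist.fixed.val (w.coaction hσ hfix b) =
      Coalgebra.comul (R := L) (b : AddMonoidAlgebra L M) := by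
  have := (AlgEquiv.ofInjective _ (w.tensor_injective hσ hfix)).apply_symm_apply
    ⟨_, w.comul_mem_range hσ hfix b⟩
  exact congrArg Subtype.val this

omit hσ [Fintype G] in
theorem counit_mem_range (x : w.untwist.fixed) :
    Coalgebra.counit (R := L) (x : AddMonoidAlgebra L M) ∈ (Algebra.ofId K L).range := by
  refine hfix _ fun g => ?_
  have h : ∀ f, σ g (Coalgebra.counit (R := L) f) =
      Coalgebra.counit (R := L) (w.untwist.act g f) := by
    intro f
    induction f using AddMonoidAlgebra.induction_linear with
    | zero => simp
    | add f g hf hg => simp only [map_add, hf, hg]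
    | single m a => simp [untwist]
  rw [h, w.untwist.mem_fixed.1 x.2]

/-- The counit of the untwisted form. -/
noncomputable def counit : w.untwist.fixed →ₐ[K] K :=
  (AlgEquiv.ofInjective (Algebra.ofId K L) (algebraMap K L).injective).symm.toAlgHom.comp
    (AlgHom.codRestrict (((Bialgebra.counitAlgHom L (AddMonoidAlgebra L M)).restrictScalars K).comp
      w.untwist.fixed.val) _ (w.counit_mem_range hfix))

omit hσ [Fintype G] in
theorem algebraMap_counit (b : w.untwist.fixed) :
    algebraMap K L (w.counit hfix b) =
      Coalgebra.counit (R := L) (b : AddMonoidAlgebra L M) := by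
  have := (AlgEquiv.ofInjective (Algebra.ofId K L) (algebraMap K L).injective).apply_symm_apply
    ⟨_, w.counit_mem_range hfix b⟩
  exact congrArg Subtype.val this

omit hσ hfix [Fintype G] in
theorem antipode_mem (x : w.untwist.fixed) :
    HopfAlgebra.antipode L (x : AddMonoidAlgebra L M) ∈ w.untwist.fixed := by
  rw [mem_fixed]
  intro g
  have h : ∀ f, w.untwist.act g (HopfAlgebra.antipode L f) =
      HopfAlgebra.antipode L (w.untwist.act g f) := by
    intro f
    induction f using AddMonoidAlgebra.induction_linear with
    | zero => simp
    | add f g hf hg => simp only [map_add, hf, hg]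
    | single m a => simp [untwist]
  rw [h, w.untwist.mem_fixed.1 x.2]

omit hσ hfix in
/-- The antipode of the untwisted form. -/
noncomputable def antipode : w.untwist.fixed →ₗ[K] w.untwist.fixed :=
  LinearMap.codRestrict w.untwist.fixed.toSubmodule
    (((HopfAlgebra.antipode L (A := AddMonoidAlgebra L M)).restrictScalars K) ∘ₗ
      w.untwist.fixed.val.toLinearMap) w.antipode_mem

/-- The comultiplication of the untwisted form. -/
noncomputable def comulHom : w.untwist.fixed →ₐ[K] w.untwist.fixed ⊗[K] w.untwist.fixed :=
  w.untwist.coaction hσ hfix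

theorem tensorToTensor_comulHom (b : w.untwist.fixed) :
    tensorToTensor L w.untwist.fixed.val w.untwist.fixed.val (w.comulHom hσ hfix b) =
      Coalgebra.comul (R := L) (b : AddMonoidAlgebra L M) :=
  w.untwist.tensorToTensor_coaction hσ hfix b

/-- The Hopf algebra structure on the untwisted form. -/
@[reducible]
noncomputable def hopfAlgebra : HopfAlgebra K w.untwist.fixed :=
  HopfAlgebra.descent (w.untwist.isBaseChange hσ hfix) (w.comulHom hσ hfix)
    (w.counit hfix) w.antipode (w.tensorToTensor_comulHom hσ hfix)
    (w.algebraMap_counit hfix) (fun _ => rfl)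

end MonomialAction

end Torsor

/-! ### Torsor axioms, geometric splitting and rationality of split tori. -/

section Torsor

/-- This is needed to embed `L` into the algebraic closure of `K`. -/
theorem algebra_isIntegral_of_fixed {K L G : Type*} [Field K] [Field L] [Algebra K L] [Group G]
    [Finite G] (σ : G →* (L ≃ₐ[K] L))
    (hfix : ∀ l : L, (∀ g, σ g l = l) → ∃ r, algebraMap K L r = l) : Algebra.IsIntegral K L := by
  let _ : MulSemiringAction G L := MulSemiringAction.compHom L σ
  have : SMulCommClass G K L := ⟨fun g r l => map_smul (σ g) r l⟩
  have : Algebra.IsInvariant K L G := ⟨hfix⟩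
  exact Algebra.IsInvariant.isIntegral K L G

theorem algebraicIndependent_single (C I : Type*) [Field C] [DecidableEq I] :
    AlgebraicIndependent C (fun i : I =>
      (AddMonoidAlgebra.single (Pi.single i 1) 1 : AddMonoidAlgebra C (I → ℤ))) := by
  let f : (I →₀ ℕ) →+ (I → ℤ) :=
    { toFun := fun m i => m i
      map_zero' := by ext; simp
      map_add' := fun m n => by ext; simp }
  have hf : Function.Injective f := fun m n h => Finsupp.ext fun i => by
    simpa [f] using congrFun h i
  have h : (MvPolynomial.aeval fun i : I =>
      (AddMonoidAlgebra.single (Pi.single i 1) 1 : AddMonoidAlgebra C (I → ℤ))) =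
      (AddMonoidAlgebra.mapDomainAlgHom C C f : MvPolynomial (I) C →ₐ[C] _) := by
    refine MvPolynomial.algHom_ext fun i => ?_
    rw [MvPolynomial.aeval_X]
    refine Eq.trans ?_ (AddMonoidAlgebra.mapDomain_single).symm
    congr 1
    ext j
    simp [f, Finsupp.single_apply, Pi.single_apply, eq_comm]
  rw [AlgebraicIndependent, h]
  exact AddMonoidAlgebra.mapDomain_injective hf

theorem adjoin_single_eq_top {C F : Type*} [Field C] [Field F] [Algebra C F] {I : Type*}
    [Fintype I] [DecidableEq I]
    [Algebra (AddMonoidAlgebra C (I → ℤ)) F]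
    [IsScalarTower C (AddMonoidAlgebra C (I → ℤ)) F]
    [IsFractionRing (AddMonoidAlgebra C (I → ℤ)) F] :
    IntermediateField.adjoin C (Set.range fun i : I =>
      algebraMap (AddMonoidAlgebra C (I → ℤ)) F
        (AddMonoidAlgebra.single (Pi.single i 1) 1)) = ⊤ := by
  set A := AddMonoidAlgebra C (I → ℤ)
  set E := IntermediateField.adjoin C (Set.range fun i : I =>
      algebraMap A F (AddMonoidAlgebra.single (Pi.single i 1) 1))
  let φ : Multiplicative (I → ℤ) →* F :=
    ((algebraMap A F : A →* F).comp (AddMonoidAlgebra.of C (I → ℤ)))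
  have hφ : ∀ m : I → ℤ, φ (.ofAdd m) ∈ E := by
    intro m
    have hm : m = ∑ i, m i • Pi.single i (1 : ℤ) := by
      ext j
      simp [Finset.sum_apply, Pi.single_apply]
    rw [hm, ofAdd_sum, map_prod]
    refine prod_mem fun i _ => ?_
    rw [ofAdd_zsmul, map_zpow]
    have hi : φ (.ofAdd (Pi.single i 1)) ∈ E := IntermediateField.subset_adjoin C _ ⟨i, rfl⟩
    exact zpow_mem hi _
  have hA : ∀ a : A, algebraMap A F a ∈ E := by
    intro a
    induction a using AddMonoidAlgebra.induction_linear with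
    | zero => simp
    | add f g hf hg => rw [map_add]; exact add_mem hf hg
    | single m c =>
      have : (AddMonoidAlgebra.single m c : A) = c • AddMonoidAlgebra.single m 1 := by simp
      rw [this]
      have h := map_smul (IsScalarTower.toAlgHom C A F) c (AddMonoidAlgebra.single m 1)
      rw [IsScalarTower.coe_toAlgHom'] at h
      rw [h]
      exact E.smul_mem (hφ m)
  refine eq_top_iff.2 fun f _ => ?_
  obtain ⟨a, b, hb, rfl⟩ := IsFractionRing.div_surjective (A := A) f
  exact div_mem (hA a) (hA b)

theorem isRational_groupAlgebra (C : Type u) [Field C] (r : ℕ) :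
    IsRational (Spec.map (CommRingCat.ofHom
      (algebraMap C (AddMonoidAlgebra C (Fin r → ℤ))))) := by
  let A := AddMonoidAlgebra C (Fin r → ℤ)
  let F := FractionRing A
  have : AddMonoid.FG (Fin r → ℤ) :=
    AddGroup.fg_iff_addMonoid_fg.1 (Module.Finite.iff_addGroup_fg.1 inferInstance)
  have : Algebra.FiniteType C A := inferInstance
  have hinj := IsFractionRing.injective A F
  let x : Fin r → F := fun i => algebraMap A F (AddMonoidAlgebra.single (Pi.single i 1) 1)
  refine isRational_of_algebraicIndependent (F := F) (IsScalarTower.toAlgHom C A F) hinj ?_ x ?_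
    adjoin_single_eq_top
  · intro f
    obtain ⟨a, b, hb, rfl⟩ := IsFractionRing.div_surjective (A := A) f
    exact ⟨a, b, nonZeroDivisors.ne_zero hb, div_mul_cancel₀ _
      ((map_ne_zero_iff _ hinj).2 (nonZeroDivisors.ne_zero hb))⟩
  · exact (algebraicIndependent_single C (Fin r)).map' (f := IsScalarTower.toAlgHom C A F) hinj

/-- After extension to `L` the map becomes the one for `A` coacting on itself. -/
theorem bijective_lift_descent {K L B H A : Type*} [Field K] [Field L] [Algebra K L]
    [CommRing B] [Algebra K B] [CommRing H] [Algebra K H]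
    [CommRing A] [Bialgebra L A] [Algebra K A] [IsScalarTower K L A]
    {i : B →ₐ[K] A} {j : H →ₐ[K] A}
    (hi : IsBaseChange L i.toLinearMap) (hj : IsBaseChange L j.toLinearMap)
    (δ : B →ₐ[K] B ⊗[K] H)
    (hδ : ∀ b, tensorToTensor L i j (δ b) = Coalgebra.comul (R := L) (i b))
    (h : Function.Bijective (Algebra.TensorProduct.lift
      (Algebra.TensorProduct.includeLeft : A →ₐ[L] A ⊗[L] A)
      (Bialgebra.comulAlgHom L A) (fun _ _ => Commute.all _ _))) :
    Function.Bijective (Algebra.TensorProduct.lift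
      (Algebra.TensorProduct.includeLeft : B →ₐ[K] B ⊗[K] H) δ (fun _ _ => Commute.all _ _)) := by
  refine IsBaseChange.bijective_descent (isBaseChange_tensorToTensor hi hi)
    (isBaseChange_tensorToTensor hi hj)
    (Algebra.TensorProduct.lift (Algebra.TensorProduct.includeLeft : B →ₐ[K] B ⊗[K] H) δ
      (fun _ _ => Commute.all _ _)).toLinearMap
    (Algebra.TensorProduct.lift (Algebra.TensorProduct.includeLeft : A →ₐ[L] A ⊗[L] A)
      (Bialgebra.comulAlgHom L A) (fun _ _ => Commute.all _ _)).toLinearMap (fun t => ?_) h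
  induction t with
  | zero => simp
  | add x y hx hy => simp only [map_add, hx, hy]
  | tmul x y => simp [hδ]

theorem isBaseChange_algHom_comp {K L C X A D : Type*} [Field K] [Field L] [Field C]
    [Algebra K L] [Algebra L C] [Algebra K C] [IsScalarTower K L C]
    [CommRing X] [Algebra K X] [CommRing A] [Algebra K A] [Algebra L A] [IsScalarTower K L A]
    [CommRing D] [Algebra K D] [Algebra L D] [Algebra C D] [IsScalarTower K C D]
    [IsScalarTower L C D] [IsScalarTower K L D]
    {f : X →ₐ[K] A} {g : A →ₐ[L] D} (hf : IsBaseChange L f.toLinearMap)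
    (hg : IsBaseChange C g.toLinearMap) :
    IsBaseChange C ((g.restrictScalars K).comp f).toLinearMap := by
  have h : ((g.restrictScalars K).comp f).toLinearMap =
    (g.toLinearMap.restrictScalars K).comp f.toLinearMap := rfl
  rw [h]
  exact IsBaseChange.comp hf hg

theorem tensorToTensor_trans {K L C H A D : Type*} [Field K] [Field L] [Field C]
    [Algebra K L] [Algebra L C] [Algebra K C] [IsScalarTower K L C]
    [CommRing H] [Algebra K H] [CommRing A] [Algebra K A] [Algebra L A] [IsScalarTower K L A]
    [CommRing D] [Algebra K D] [Algebra L D] [Algebra C D] [IsScalarTower K C D]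
    [IsScalarTower L C D] [IsScalarTower K L D] (f : H →ₐ[K] A) (g : A →ₐ[L] D)
    (E : C ⊗[K] H →ₐ[C] D) (hE : ∀ h, E (1 ⊗ₜ h) = g (f h)) (t : H ⊗[K] H) :
    tensorToTensor C g g (tensorToTensor L f f t) =
      tensorToTensor C (((E.restrictScalars K).comp Algebra.TensorProduct.includeRight))
        (((E.restrictScalars K).comp Algebra.TensorProduct.includeRight)) t := by
  induction t with
  | zero => simp
  | add x y hx hy => simp only [map_add, hx, hy]
  | tmul x y => simp [hE]

theorem map_comul_one_tmul {K C H D : Type*} [Field K] [Field C] [Algebra K C]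
    [CommRing H] [Bialgebra K H] [CommRing D] [Algebra K D] [Algebra C D] [IsScalarTower K C D]
    (E : C ⊗[K] H →ₐ[C] D) (h : H) :
    Algebra.TensorProduct.map E E (Coalgebra.comul (R := C) ((1 : C) ⊗ₜ[K] h)) =
      tensorToTensor C (((E.restrictScalars K).comp Algebra.TensorProduct.includeRight))
        (((E.restrictScalars K).comp Algebra.TensorProduct.includeRight))
        (Coalgebra.comul (R := K) h) := by
  rw [TensorProduct.comul_tmul, CommSemiring.comul_apply]
  generalize Coalgebra.comul (R := K) h = t
  induction t with
  | zero => simp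
  | add x y hx hy => simp only [map_add, hx, hy, tmul_add]
  | tmul x y => simp

namespace MonomialAction

variable {K L G : Type u} [Field K] [Field L] [Algebra K L] [Group G] [Fintype G]
  {σ : G →* (L ≃ₐ[K] L)} {M : Type u} [AddCommGroup M] (w : MonomialAction σ M)
  (hσ : Function.Injective σ)
  (hfix : ∀ l : L, (∀ g, σ g l = l) → ∃ r, algebraMap K L r = l)

include hσ hfix

/-- Over `L` the twisted and the untwisted forms both become `L[M]` and the coaction becomes its
comultiplication, so every axiom descends from a split torus acting on itself. -/
theorem isTorsor_coaction :
    letI := w.hopfAlgebra hσ hfix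
    IsTorsor (w.coaction hσ hfix) := by
  let _ := w.hopfAlgebra hσ hfix
  have hΔ : Bialgebra.comulAlgHom K w.untwist.fixed = w.comulHom hσ hfix := rfl
  have hε : Bialgebra.counitAlgHom K w.untwist.fixed = w.counit hfix := rfl
  refine ⟨inferInstance, ?_, ?_, ?_⟩
  · rw [hΔ]
    exact coassoc_descent (w.isBaseChange hσ hfix) (w.untwist.isBaseChange hσ hfix)
      (w.coaction hσ hfix) (w.comulHom hσ hfix)
      (w.tensorToTensor_coaction hσ hfix) (w.tensorToTensor_comulHom hσ hfix)
  · rw [hε]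
    exact AlgHom.ext (lTensor_counit_descent (w.isBaseChange hσ hfix) (w.coaction hσ hfix)
      (w.counit hfix) (w.tensorToTensor_coaction hσ hfix) (w.algebraMap_counit hfix))
  · exact bijective_lift_descent (w.isBaseChange hσ hfix) (w.untwist.isBaseChange hσ hfix)
      (w.coaction hσ hfix) (w.tensorToTensor_coaction hσ hfix) bijective_lift_comul

variable {C : Type u} [Field C] [Algebra L C] [Algebra K C] [IsScalarTower K L C]
  {N : Type*} [AddCommGroup N] (e : M ≃+ N)

omit hσ hfix [Fintype G] in
variable (C) in
/-- The fixed algebra in the group algebra over a larger field. -/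
noncomputable def toGroupAlgebra : w.fixed →ₐ[K] AddMonoidAlgebra C N :=
  ((groupAlgebraBaseChange L C e).restrictScalars K).comp w.fixed.val

theorem isBaseChange_toGroupAlgebra : IsBaseChange C (w.toGroupAlgebra C e).toLinearMap :=
  isBaseChange_algHom_comp (w.isBaseChange hσ hfix) (isBaseChange_groupAlgebraBaseChange e)

omit hσ hfix [Fintype G] in
variable (C) in
/-- The canonical map from the scalar extension of the fixed algebra. -/
noncomputable def baseChangeHom : C ⊗[K] w.fixed →ₐ[C] AddMonoidAlgebra C N :=
  Algebra.TensorProduct.lift (Algebra.ofId _ _) (w.toGroupAlgebra C e) (fun _ _ => Commute.all _ _)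

omit hσ hfix [Fintype G] in
theorem baseChangeHom_tmul (c : C) (b : w.fixed) :
    w.baseChangeHom C e (c ⊗ₜ b) = c • w.toGroupAlgebra C e b := by
  simp [baseChangeHom, Algebra.ofId_apply, Algebra.smul_def]

theorem bijective_baseChangeHom : Function.Bijective (w.baseChangeHom C e) := by
  have h := w.isBaseChange_toGroupAlgebra hσ hfix (C := C) e
  have : ⇑(w.baseChangeHom C e) = h.equiv := by
    funext t
    induction t with
    | zero => simp
    | add x y hx hy => rw [map_add, map_add, hx, hy]
    | tmul c b => rw [baseChangeHom_tmul, h.equiv_tmul]; rfl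
  rw [this]
  exact h.equiv.bijective

include e in
-- The untwisted form becomes `L[M]` over `L`, hence `C[N]` over `C`. The counit and
-- comultiplication need only be compared on `1 ⊗ h`, where both sides factor through `L[M]`.
theorem exists_bialgEquiv :
    letI := w.hopfAlgebra hσ hfix
    Nonempty ((C ⊗[K] w.untwist.fixed) ≃ₐc[C] AddMonoidAlgebra C N) := by
  let _ := w.hopfAlgebra hσ hfix
  let E := AlgEquiv.ofBijective _ (w.untwist.bijective_baseChangeHom hσ hfix (C := C) e)
  have hE : ∀ h : w.untwist.fixed, E (1 ⊗ₜ h) =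
      groupAlgebraBaseChange L C e (h : AddMonoidAlgebra L M) := fun h => by
    refine (w.untwist.baseChangeHom_tmul e 1 h).trans ?_
    rw [one_smul]
    rfl
  refine ⟨BialgEquiv.ofAlgEquiv E ?_ ?_⟩
  · refine Algebra.TensorProduct.ext (Subsingleton.elim _ _) (AlgHom.ext fun h => ?_)
    change Coalgebra.counit (R := C) (E (1 ⊗ₜ h)) =
      Coalgebra.counit (R := C) ((1 : C) ⊗ₜ[K] h)
    rw [hE, counit_groupAlgebraBaseChange, TensorProduct.counit_tmul]
    have h2 := w.algebraMap_counit hfix h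
    rw [← h2, ← IsScalarTower.algebraMap_apply]
    simp [Algebra.smul_def]
    rfl
  · refine Algebra.TensorProduct.ext (Subsingleton.elim _ _) (AlgHom.ext fun h => ?_)
    change Algebra.TensorProduct.map E.toAlgHom E.toAlgHom
      (Coalgebra.comul (R := C) ((1 : C) ⊗ₜ[K] h)) = Coalgebra.comul (R := C) (E (1 ⊗ₜ h))
    rw [hE, comul_groupAlgebraBaseChange, ← w.tensorToTensor_comulHom hσ hfix h,
      map_comul_one_tmul]
    exact (tensorToTensor_trans w.untwist.fixed.val (groupAlgebraBaseChange L C e) E.toAlgHom hE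
      _).symm

end MonomialAction

end Torsor

/-! ### The tower step attached to a monomial action. -/

section ToricStep

/-- A twisted form of a split torus over the function field of `Spec R`, split by a finite Galois
extension, is the generic fibre of a step of a toric rational tower. -/
theorem MonomialAction.hasToricTower {k R : Type u} [Field k] [CommRing R] [IsDomain R]
    [Algebra k R] [Algebra.FiniteType k R]
    {L G : Type u} [Field L] [Algebra (specFunctionField R) L] [Algebra R L] [Algebra k L]
    [IsScalarTower R (specFunctionField R) L] [IsScalarTower k R L]
    [Algebra k (specFunctionField R)] [IsScalarTower k R (specFunctionField R)]
    [IsScalarTower k (specFunctionField R) L]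
    [Group G] [Finite G] {σ : G →* (L ≃ₐ[specFunctionField R] L)}
    (hσ : Function.Injective σ)
    (hfix : ∀ l : L, (∀ g, σ g l = l) → ∃ r, algebraMap (specFunctionField R) L r = l)
    {M : Type u} [AddCommGroup M] [Module.Free ℤ M] [Module.Finite ℤ M] (w : MonomialAction σ M)
    (next : ∀ (S : Subalgebra R w.fixed) [IsDomain S] [Algebra.FiniteType k S],
      (∀ b : w.fixed, ∃ r : R, r ≠ 0 ∧ r • b ∈ S) → (Variety.ofDomain k S).HasToricTower) :
    (Variety.ofDomain k R).HasToricTower := by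
  let K := specFunctionField R
  let C := AlgebraicClosure K
  have := Fintype.ofFinite G
  have hint := algebra_isIntegral_of_fixed σ hfix
  let r := Module.finrank ℤ M
  let e : M ≃+ (Fin r → ℤ) := (Module.finBasis ℤ M).equivFun.toAddEquiv
  -- The splitting field `L` is placed inside the algebraic closure, so that the geometric fibre
  -- becomes a split torus.
  let ι : L →ₐ[K] C := IsAlgClosed.lift
  let _ : Algebra L C := ι.toRingHom.toAlgebra
  have : IsScalarTower K L C := IsScalarTower.of_algebraMap_eq fun x => (ι.commutes x).symm
  let _ := w.hopfAlgebra hσ hfix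
  let E := AlgEquiv.ofBijective _ (w.bijective_baseChangeHom hσ hfix (C := C) e)
  have hdom : IsDomain (C ⊗[K] w.fixed) := E.toMulEquiv.isDomain _
  have : AddMonoid.FG (Fin r → ℤ) :=
    AddGroup.fg_iff_addMonoid_fg.1 (Module.Finite.iff_addGroup_fg.1 inferInstance)
  have hft : Algebra.FiniteType C (C ⊗[K] w.fixed) :=
    Algebra.FiniteType.equiv inferInstance E.symm
  have : Algebra.FiniteType K w.fixed :=
    Algebra.FiniteType.of_finiteType_tensorProduct_of_faithfullyFlat C
  have hrat : IsRational (Spec.map (CommRingCat.ofHom (algebraMap C (C ⊗[K] w.fixed)))) := by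
    obtain ⟨d, hd⟩ := isRational_groupAlgebra C r
    exact ⟨d, (birationalOver_of_algEquiv E).trans hd⟩
  have : NoZeroDivisors (AddMonoidAlgebra L M) := by
    have hinj := (isBaseChange_groupAlgebraBaseChange (L := L) (C := L) e).injective_of_field
    exact hinj.noZeroDivisors (groupAlgebraBaseChange L L e) (map_zero _) (map_mul _)
  have : IsDomain (AddMonoidAlgebra L M) := NoZeroDivisors.to_isDomain _
  exact Variety.HasToricTower.of_torsor (w.coaction hσ hfix)
    ⟨r, w.exists_bialgEquiv hσ hfix e⟩ (w.isTorsor_coaction hσ hfix) hdom hrat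
    fun S _ hS => next S hS

end ToricStep

/-! ### Invariants in a field of fractions. -/

section Fractions

variable {k A F Γ : Type*} [Field k] [CommRing A] [IsDomain A] [Algebra k A] [Field F]
  [Algebra A F] [IsFractionRing A F] [Algebra k F] [IsScalarTower k A F] [Group Γ]

variable (F) in
/-- The action induced on a field of fractions. -/
noncomputable def fractionAction (τ : Γ →* (A ≃ₐ[k] A)) : Γ →* (F ≃ₐ[k] F) :=
  (IsFractionRing.fieldEquivOfAlgEquivHom k F).comp τ

omit [IsDomain A] in
@[simp]
theorem fractionAction_algebraMap (τ : Γ →* (A ≃ₐ[k] A)) (γ : Γ) (a : A) :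
    fractionAction F τ γ (algebraMap A F a) = algebraMap A F (τ γ a) :=
  IsFractionRing.fieldEquivOfAlgEquiv_algebraMap k F F _ _

/-- An invariant fraction is a fraction of invariants. -/
theorem exists_fixed_of_fractionAction_eq [Finite Γ] (τ : Γ →* (A ≃ₐ[k] A)) (f : F)
    (hf : ∀ γ, fractionAction F τ γ f = f) :
    ∃ a b : A, (∀ γ, τ γ a = a) ∧ (∀ γ, τ γ b = b) ∧ b ≠ 0 ∧
      f * algebraMap A F b = algebraMap A F a := by
  classical
  have := Fintype.ofFinite Γ
  have hinj := IsFractionRing.injective A F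
  obtain ⟨p, q, hq, rfl⟩ := IsFractionRing.div_surjective (A := A) f
  have hq0 := nonZeroDivisors.ne_zero hq
  -- The norm of `q` is an invariant denominator; the numerator is then invariant as well, because
  -- the quotient is.
  let b := ∏ γ, τ γ q
  have hb : ∀ γ, τ γ b = b := fun γ => by
    simp only [b, map_prod]
    rw [← Equiv.prod_comp (Equiv.mulLeft γ) (fun δ => τ δ q)]
    simp
  have hab : algebraMap A F p / algebraMap A F q * algebraMap A F b =
      algebraMap A F (p * ∏ γ ∈ Finset.univ.erase 1, τ γ q) := by
    have h1 : b = q * ∏ γ ∈ Finset.univ.erase 1, τ γ q := by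
      simp only [b]
      rw [← Finset.mul_prod_erase _ _ (Finset.mem_univ (1 : Γ))]
      simp
    rw [h1, map_mul, map_mul, ← mul_assoc,
      div_mul_cancel₀ _ ((map_ne_zero_iff _ hinj).2 hq0)]
  refine ⟨_, b, fun γ => hinj ?_, hb, Finset.prod_ne_zero_iff.2 fun γ _ => ?_, hab⟩
  · rw [← fractionAction_algebraMap, ← hab, map_mul, hf, fractionAction_algebraMap, hb]
  · exact (map_ne_zero_iff _ (τ γ).injective).2 hq0

end Fractions

/-! ### Monomial extensions of an action: removing the kernel and descending. -/

namespace MonomialAction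

variable {k L G : Type*} [Field k] [Field L] [Algebra k L] [Group G]
  {σ : G →* (L ≃ₐ[k] L)} {M : Type*} [AddCommGroup M]

/-- The action on the group algebra by automorphisms. -/
noncomputable def actEquiv (w : MonomialAction σ M) :
    G →* (AddMonoidAlgebra L M ≃ₐ[k] AddMonoidAlgebra L M) where
  toFun g := AlgEquiv.ofAlgHom (w.act g) (w.act g⁻¹)
    (AlgHom.ext fun f => by
      rw [AlgHom.comp_apply, ← w.act_mul, mul_inv_cancel, w.act_one]; rfl)
    (AlgHom.ext fun f => by
      rw [AlgHom.comp_apply, ← w.act_mul, inv_mul_cancel, w.act_one]; rfl)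
  map_one' := AlgEquiv.ext w.act_one
  map_mul' g h := AlgEquiv.ext (w.act_mul g h)

@[simp]
theorem actEquiv_apply (w : MonomialAction σ M) (g : G) (f : AddMonoidAlgebra L M) :
    w.actEquiv g f = w.act g f := rfl

theorem coeff_act (w : MonomialAction σ M) (g : G) (hg : σ g = 1) (hp : ∀ m, w.perm g m = m)
    (f : AddMonoidAlgebra L M) (m : M) :
    (w.act g f).coeff m = f.coeff m * w.coeff g (.ofAdd m) := by
  classical
  induction f using AddMonoidAlgebra.induction_linear with
  | zero => simp
  | add f g hf hg => simp [hf, hg, add_mul]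
  | single n a =>
    rw [act_single, hp, hg]
    simp only [AddMonoidAlgebra.coeff_single, Finsupp.single_apply, AlgEquiv.one_apply]
    split_ifs with h
    · rw [h]
    · simp

variable {Γ : Type*} [Group Γ] {q : Γ →* G} (w : MonomialAction (σ.comp q) M)

/-- The exponents of the monomials fixed by the kernel of `q`. -/
def kernelInvariants : Submodule ℤ M :=
  AddSubgroup.toIntSubmodule
    { carrier := {m | ∀ γ, q γ = 1 → w.coeff γ (.ofAdd m) = 1}
      zero_mem' := fun γ _ => map_one _
      add_mem' := fun hm hn γ hγ => by rw [ofAdd_add, map_mul, hm γ hγ, hn γ hγ, one_mul]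
      neg_mem' := fun {m} hm γ hγ => by
        have h : w.coeff γ (.ofAdd (-m)) * w.coeff γ (.ofAdd m) = 1 := by
          rw [← map_mul, ← ofAdd_add, neg_add_cancel, ofAdd_zero, map_one]
        rwa [hm γ hγ, mul_one] at h }

theorem coeff_ne_zero {σ : G →* (L ≃ₐ[k] L)} (w : MonomialAction σ M) (g : G)
    (m : Multiplicative M) : w.coeff g m ≠ 0 := fun h => by
  have h1 : w.coeff g m * w.coeff g m⁻¹ = 1 := by rw [← map_mul, mul_inv_cancel, map_one]
  rw [h, zero_mul] at h1
  exact zero_ne_one h1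

variable {p : G →* AddMonoid.End M} (hp : ∀ γ m, w.perm γ m = p (q γ) m)

include hp

theorem coeff_mul_of_kernel (δ γ : Γ) (hγ : q γ = 1) {m : M} (hm : m ∈ w.kernelInvariants) :
    w.coeff (δ * γ) (.ofAdd m) = w.coeff δ (.ofAdd m) := by
  rw [w.coeff_mul, hm γ hγ, map_one, mul_one, hp, hγ, map_one, AddMonoid.End.coe_one, id]

theorem coeff_eq_of_map_eq {γ δ : Γ} (h : q γ = q δ) {m : M} (hm : m ∈ w.kernelInvariants) :
    w.coeff γ (.ofAdd m) = w.coeff δ (.ofAdd m) := by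
  rw [← w.coeff_mul_of_kernel hp δ (δ⁻¹ * γ) (by simp [h]) hm, mul_inv_cancel_left]

/-- For `γ` in the kernel, `γ * δ` and `δ` have the same image in `G`, hence the same scalar on `m`.
The cocycle identity then forces the scalar of `γ` on the translated exponent to be one. -/
theorem perm_mem_kernelInvariants (δ : Γ) {m : M} (hm : m ∈ w.kernelInvariants) :
    p (q δ) m ∈ w.kernelInvariants := fun γ hγ => by
  have h1 := w.coeff_mul γ δ m
  rw [w.coeff_eq_of_map_eq hp (γ := γ * δ) (δ := δ) (by simp [hγ]) hm, hp] at h1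
  simp only [MonoidHom.comp_apply, hγ, map_one, AlgEquiv.one_apply] at h1
  exact (mul_eq_right₀ (w.coeff_ne_zero _ _)).1 h1.symm

variable (hq : Function.Surjective q)
  {K : Type*} [Field K] [Algebra K L] {σK : G →* (L ≃ₐ[K] L)} (hσK : ∀ g l, σK g l = σ g l)

/-- The action of the quotient group on the monomials fixed by the kernel. -/
noncomputable def descend : MonomialAction σK w.kernelInvariants where
  perm :=
    { toFun := fun g =>
        { toFun := fun m => ⟨p g m, by
            obtain ⟨γ, rfl⟩ := hq g
            exact w.perm_mem_kernelInvariants hp γ m.2⟩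
          map_zero' := Subtype.ext (map_zero _)
          map_add' := fun m n => Subtype.ext (map_add _ _ _) }
      map_one' := by
        ext m
        exact congrArg (fun f : AddMonoid.End M => f m) p.map_one
      map_mul' := fun g h => by
        ext m
        exact congrArg (fun f : AddMonoid.End M => f m) (p.map_mul g h) }
  -- Any lift of `g` would do: on these exponents the scalar depends only on the image in `G`.
  coeff g := (w.coeff (Function.surjInv hq g)).comp
    (AddMonoidHom.toMultiplicative w.kernelInvariants.subtype.toAddMonoidHom)
  coeff_one m := by
    refine m.2 _ ?_
    rw [Function.surjInv_eq hq]
  coeff_mul g h m := by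
    refine (w.coeff_eq_of_map_eq hp (δ := Function.surjInv hq g * Function.surjInv hq h)
      (by simp [Function.surjInv_eq hq]) m.2).trans ?_
    have h1 := w.coeff_mul (Function.surjInv hq g) (Function.surjInv hq h) (m : M)
    have h2 : ∀ g, q (Function.surjInv hq g) = g := Function.surjInv_eq hq
    rw [MonoidHom.comp_apply, h2, ← hσK, hp, h2] at h1
    exact h1

/-- The inclusion of the group algebra of the fixed monomials. -/
noncomputable def kernelInclusion (w : MonomialAction (σ.comp q) M) :
    AddMonoidAlgebra L w.kernelInvariants →ₐ[L] AddMonoidAlgebra L M :=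
  AddMonoidAlgebra.mapDomainAlgHom L L w.kernelInvariants.subtype.toAddMonoidHom

omit hp in
theorem kernelInclusion_injective : Function.Injective w.kernelInclusion :=
  AddMonoidAlgebra.mapDomain_injective Subtype.val_injective

omit hp in
@[simp]
theorem kernelInclusion_single (m : w.kernelInvariants) (a : L) :
    w.kernelInclusion (AddMonoidAlgebra.single m a) = AddMonoidAlgebra.single (m : M) a :=
  AddMonoidAlgebra.mapDomain_single

theorem act_kernelInclusion (γ : Γ) (f : AddMonoidAlgebra L w.kernelInvariants) :
    w.act γ (w.kernelInclusion f) =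
      w.kernelInclusion ((w.descend hp hq hσK).act (q γ) f) := by
  induction f using AddMonoidAlgebra.induction_linear with
  | zero => simp
  | add f g hf hg => simp only [map_add, hf, hg]
  | single m a =>
    rw [kernelInclusion_single, act_single, act_single, kernelInclusion_single, hp, hσK]
    congr 2
    exact w.coeff_eq_of_map_eq hp (by rw [Function.surjInv_eq hq]) m.2

/-- The kernel of `q` acts diagonally on monomials, so a fixed element is supported on
`kernelInvariants`. The remaining invariance is under `G`. -/
theorem exists_fixed_of_act_eq (f : AddMonoidAlgebra L M) (hf : ∀ γ, w.act γ f = f) :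
    ∃ b : (w.descend hp hq hσK).fixed, w.kernelInclusion b = f := by
  have hsupp : (f.coeff.support : Set M) ⊆ Set.range w.kernelInvariants.subtype.toAddMonoidHom := by
    intro m hm
    refine ⟨⟨m, fun γ hγ => ?_⟩, rfl⟩
    have h1 := w.coeff_act γ (by simp [hγ]) (fun m => by simp [hp, hγ]) f m
    rw [hf] at h1
    exact (mul_eq_left₀ (Finsupp.mem_support_iff.1 hm)).1 h1.symm
  have h2 := AddMonoidAlgebra.mapDomain_comapDomain hsupp Subtype.val_injective
  refine ⟨⟨_, (mem_fixed _).2 fun g => w.kernelInclusion_injective ?_⟩, h2⟩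
  obtain ⟨γ, rfl⟩ := hq g
  rw [← act_kernelInclusion]
  exact (congrArg _ h2).trans ((hf γ).trans h2.symm)

end MonomialAction

/-- Every affine variety whose function field is the fixed field of the action `σ` admits a toric
rational tower. -/
def QuotientHasTower {k Ω G : Type u} [Field k] [Field Ω] [Algebra k Ω] [Group G]
    (σ : G →* (Ω ≃ₐ[k] Ω)) : Prop :=
  ∀ (R : Type u) [CommRing R] [IsDomain R] [Algebra k R] [Algebra.FiniteType k R]
    (i : R →ₐ[k] Ω), Function.Injective i → (∀ g r, σ g (i r) = i r) →
    (∀ f, (∀ g, σ g f = f) → ∃ a b : R, b ≠ 0 ∧ f * i b = i a) →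
    (Variety.ofDomain k R).HasToricTower

namespace MonomialAction

variable {k L G Γ M : Type u} [Field k] [Field L] [Algebra k L] [Group G] [Group Γ]
  [AddCommGroup M] [IsDomain (AddMonoidAlgebra L M)]

/-- The action on the field of fractions of the group algebra. -/
noncomputable abbrev fieldAction {σ : G →* (L ≃ₐ[k] L)} (w : MonomialAction σ M) :
    G →* (FractionRing (AddMonoidAlgebra L M) ≃ₐ[k] FractionRing (AddMonoidAlgebra L M)) :=
  fractionAction _ w.actEquiv

variable [Finite G] [Finite Γ] [Module.Free ℤ M] [Module.Finite ℤ M]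
  {q : Γ →* G} (hq : Function.Surjective q) {σ : G →* (L ≃ₐ[k] L)}
  (hσ : Function.Injective σ) (w : MonomialAction (σ.comp q) M)
  {p : G →* AddMonoid.End M} (hp : ∀ γ m, w.perm γ m = p (q γ) m)

include hq hσ hp in
/-- A monomial extension of an action is a step of a toric rational tower. -/
theorem quotientHasTower (h : QuotientHasTower w.fieldAction) : QuotientHasTower σ := by
  intro R _ _ _ _ i hi hfixed hfrac
  -- The fraction field `K` of `R` is identified with the fixed field of `G` in `L`: `hfixed` shows
  -- that its image is fixed, and `hfrac` that it is everything fixed.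
  let K := specFunctionField R
  let _ : Algebra R L := i.toRingHom.toAlgebra
  let _ : Algebra K L := (IsFractionRing.lift (K := K) (g := i.toRingHom) hi).toAlgebra
  have : IsScalarTower k R L := IsScalarTower.of_algebraMap_eq fun x => (i.commutes x).symm
  have : IsScalarTower R K L := IsScalarTower.of_algebraMap_eq fun x =>
    (IsFractionRing.lift_algebraMap hi x).symm
  let _ : Algebra k K := ((algebraMap R K).comp (algebraMap k R)).toAlgebra
  have : IsScalarTower k R K := IsScalarTower.of_algebraMap_eq fun x => rfl
  have : IsScalarTower k K L := IsScalarTower.of_algebraMap_eq fun x => by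
    rw [IsScalarTower.algebraMap_apply k R L, IsScalarTower.algebraMap_apply k R K,
      ← IsScalarTower.algebraMap_apply R K L]
  have hRL : ∀ r, algebraMap R L r = i r := fun r => rfl
  have hK : ∀ g (x : K), σ g (algebraMap K L x) = algebraMap K L x := by
    intro g x
    obtain ⟨a, b, -, rfl⟩ := IsFractionRing.div_surjective (A := R) x
    simp only [map_div₀, ← IsScalarTower.algebraMap_apply R K L, hRL, hfixed]
  let σK : G →* (L ≃ₐ[K] L) :=
    { toFun := fun g => AlgEquiv.ofRingEquiv (f := (σ g).toRingEquiv) (hK g)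
      map_one' := by ext x; exact congrArg (fun f : L ≃ₐ[k] L => f x) σ.map_one
      map_mul' := fun g h => by
        ext x; exact congrArg (fun f : L ≃ₐ[k] L => f x) (σ.map_mul g h) }
  have hσK : ∀ g l, σK g l = σ g l := fun g l => rfl
  have hσKinj : Function.Injective σK := fun g h hgh => hσ <| AlgEquiv.ext fun l =>
    congrArg (fun f : L ≃ₐ[K] L => f l) hgh
  have hfix : ∀ l : L, (∀ g, σK g l = l) → ∃ r, algebraMap K L r = l := by
    intro l hl
    obtain ⟨a, b, hb, hab⟩ := hfrac l hl
    refine ⟨algebraMap R K a / algebraMap R K b, ?_⟩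
    rw [map_div₀, ← IsScalarTower.algebraMap_apply R K L,
      ← IsScalarTower.algebraMap_apply R K L, hRL, hRL, ← hab,
      mul_div_cancel_right₀ _ ((map_ne_zero_iff _ hi).2 hb)]
  -- The descended action gives the torsor. It remains to see that each model `S` of it has function
  -- field `Frac(L[M])^Γ`, so that `h` applies.
  refine (w.descend hp hq hσK).hasToricTower hσKinj hfix fun S _ _ hS => ?_
  let j : (w.descend hp hq hσK).fixed →ₐ[k] FractionRing (AddMonoidAlgebra L M) :=
    (IsScalarTower.toAlgHom k (AddMonoidAlgebra L M) _).comp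
      ((w.kernelInclusion.restrictScalars k).comp
        ((w.descend hp hq hσK).fixed.val.restrictScalars k))
  have hj0 : ∀ b, j b = algebraMap _ _ (w.kernelInclusion b) := fun b => rfl
  have hj : Function.Injective j := (IsFractionRing.injective (AddMonoidAlgebra L M) _).comp
    (w.kernelInclusion_injective.comp Subtype.val_injective)
  refine h S (j.comp (S.val.restrictScalars k)) (hj.comp Subtype.val_injective) ?_ ?_
  · intro γ s
    change w.fieldAction γ (j s) = j s
    rw [hj0, fractionAction_algebraMap, actEquiv_apply, w.act_kernelInclusion hp hq hσK,
      (mem_fixed _).1 (s : (w.descend hp hq hσK).fixed).2]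
  · intro f hf
    obtain ⟨a, b, ha, hb, hb0, hab⟩ := exists_fixed_of_fractionAction_eq w.actEquiv f hf
    obtain ⟨a, rfl⟩ := w.exists_fixed_of_act_eq hp hq hσK a ha
    obtain ⟨b, rfl⟩ := w.exists_fixed_of_act_eq hp hq hσK b hb
    -- The invariant numerator and denominator lie in the torsor algebra; multiplying by nonzero
    -- elements of `R` moves them into the model `S`.
    obtain ⟨r, hr, hra⟩ := hS a
    obtain ⟨s, hs, hsb⟩ := hS b
    have hu : ∀ (r : R), r ≠ 0 → algebraMap R (w.descend hp hq hσK).fixed r ≠ 0 := by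
      intro r hr h0
      rw [IsScalarTower.algebraMap_apply R K] at h0
      have h1 := (algebraMap K (w.descend hp hq hσK).fixed).injective (h0.trans (map_zero _).symm)
      exact hr (IsFractionRing.injective R K (h1.trans (map_zero _).symm))
    have hb1 : b ≠ 0 := fun h0 => hb0 (by rw [h0]; simp)
    refine ⟨s • ⟨_, hra⟩, r • ⟨_, hsb⟩, fun h0 => ?_, ?_⟩
    · have h1 : r • s • b = 0 := congrArg Subtype.val h0
      replace h1 := congrArg j h1
      rw [Algebra.smul_def, Algebra.smul_def, map_mul, map_mul, map_zero] at h1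
      have hj1 : ∀ b, b ≠ 0 → j b ≠ 0 := fun b hb => (map_ne_zero_iff _ hj).2 hb
      exact mul_ne_zero (hj1 _ (hu r hr)) (mul_ne_zero (hj1 _ (hu s hs)) (hj1 _ hb1)) h1
    · change f * j (r • s • b) = j (s • r • a)
      rw [smul_comm s r a]
      simp only [Algebra.smul_def, map_mul]
      rw [hj0 b, hj0 a, ← hab]
      ring

end MonomialAction

/-- A faithful action on a field which is linear in suitable generators of a purely
transcendental extension. -/
structure IsLinearAction {k Ω G : Type u} [Field k] [Field Ω] [Algebra k Ω] [Group G]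
    (σ : G →* (Ω ≃ₐ[k] Ω)) : Prop where
  injective : Function.Injective σ
  exists_generators : ∃ (ι : Type u) (_ : Finite ι) (x : ι → Ω), AlgebraicIndependent k x ∧
    IntermediateField.adjoin k (Set.range x) = ⊤ ∧
    ∀ g i, σ g (x i) ∈ Submodule.span k (Set.range x)

/-- The quotients by all faithful linear actions of the group have towers. -/
def HasLinearTowers (k G : Type u) [Field k] [Group G] : Prop :=
  ∀ (Ω : Type u) [Field Ω] [Algebra k Ω] (σ : G →* (Ω ≃ₐ[k] Ω)),
    IsLinearAction σ → QuotientHasTower σ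

/-! ### Restricting linear actions to stable subfields. -/

section Restrict

variable {k Ω G : Type u} [Field k] [Field Ω] [Algebra k Ω] [Group G]

/-- The restriction of an action to a stable intermediate field. -/
noncomputable def IntermediateField.restrictAction (E : IntermediateField k Ω)
    (σ : G →* (Ω ≃ₐ[k] Ω)) (hE : ∀ g, ∀ x ∈ E, σ g x ∈ E) : G →* (E ≃ₐ[k] E) :=
  let f : G → E →ₐ[k] E := fun g =>
    ((σ g : Ω →ₐ[k] Ω).comp E.val).codRestrict E.toSubalgebra fun x => hE g x x.2
  have h1 : f 1 = AlgHom.id k E := AlgHom.ext fun x => Subtype.ext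
    (congrArg (fun e : Ω ≃ₐ[k] Ω => e x) σ.map_one)
  have h2 : ∀ g h, f (g * h) = (f g).comp (f h) := fun g h => AlgHom.ext fun x => Subtype.ext
    (congrArg (fun e : Ω ≃ₐ[k] Ω => e x) (σ.map_mul g h))
  { toFun := fun g => AlgEquiv.ofAlgHom (f g) (f g⁻¹)
      (by rw [← h2, mul_inv_cancel, h1]) (by rw [← h2, inv_mul_cancel, h1])
    map_one' := AlgEquiv.ext fun x => congrArg (fun e : E →ₐ[k] E => e x) h1
    map_mul' := fun g h => AlgEquiv.ext fun x => congrArg (fun e : E →ₐ[k] E => e x) (h2 g h) }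

/-- An intermediate field generated by a family with stable span is stable. -/
theorem IntermediateField.map_mem_adjoin {σ : Ω →ₐ[k] Ω} {S : Set Ω}
    (hS : ∀ s ∈ S, σ s ∈ IntermediateField.adjoin k S) {x : Ω}
    (hx : x ∈ IntermediateField.adjoin k S) : σ x ∈ IntermediateField.adjoin k S := by
  have : IntermediateField.adjoin k S ≤ (IntermediateField.adjoin k S).comap σ :=
    IntermediateField.adjoin_le_iff.2 hS
  exact this hx

theorem IntermediateField.span_le_adjoin (S : Set Ω) {x : Ω} (hx : x ∈ Submodule.span k S) :
    x ∈ IntermediateField.adjoin k S := by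
  have : Submodule.span k S ≤ (IntermediateField.adjoin k S).toSubalgebra.toSubmodule :=
    Submodule.span_le.2 (IntermediateField.subset_adjoin k S)
  exact this hx

theorem AlgHom.mem_span_of_mem_span_image {E : Type*} [Field E] [Algebra k E] (f : E →ₐ[k] Ω)
    (hf : Function.Injective f) {s : Set E} {y : E} (h : f y ∈ Submodule.span k (f '' s)) :
    y ∈ Submodule.span k s := by
  have h1 := Submodule.map_span f.toLinearMap s
  rw [AlgHom.coe_toLinearMap] at h1
  rw [← h1] at h
  obtain ⟨z, hz, hzy⟩ := h
  exact hf hzy ▸ hz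

/-- The linear action may be given on a subfield of a larger field with action. -/
theorem HasLinearTowers.of_adjoin (hG : HasLinearTowers k G) (σ : G →* (Ω ≃ₐ[k] Ω))
    {ι : Type u} [Finite ι] (x : ι → Ω) (hx : AlgebraicIndependent k x)
    (hspan : ∀ g i, σ g (x i) ∈ Submodule.span k (Set.range x))
    (hfaith : ∀ g, (∀ i, σ g (x i) = x i) → g = 1)
    (R : Type u) [CommRing R] [IsDomain R] [Algebra k R] [Algebra.FiniteType k R]
    (i : R →ₐ[k] Ω) (hi : Function.Injective i)
    (hrange : ∀ r, i r ∈ IntermediateField.adjoin k (Set.range x))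
    (hfixed : ∀ g r, σ g (i r) = i r)
    (hfrac : ∀ f ∈ IntermediateField.adjoin k (Set.range x), (∀ g, σ g f = f) →
      ∃ a b : R, b ≠ 0 ∧ f * i b = i a) :
    (Variety.ofDomain k R).HasToricTower := by
  let E := IntermediateField.adjoin k (Set.range x)
  have hE : ∀ g, ∀ x ∈ E, σ g x ∈ E := fun g y hy =>
    IntermediateField.map_mem_adjoin (σ := (σ g : Ω →ₐ[k] Ω)) (by
      rintro _ ⟨j, rfl⟩
      exact IntermediateField.span_le_adjoin _ (hspan g j)) hy
  have hmem : ∀ j, x j ∈ E := fun j => IntermediateField.subset_adjoin k _ ⟨j, rfl⟩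
  let x' : ι → E := fun j => ⟨x j, hmem j⟩
  have himage : E.val '' Set.range x' = Set.range x := by
    rw [← Set.range_comp]
    rfl
  refine hG E (E.restrictAction σ hE) ⟨?_, ι, inferInstance, x', ?_, ?_, ?_⟩ R
    (i.codRestrict E.toSubalgebra hrange) (fun a b h => hi (congrArg Subtype.val h))
    (fun g r => Subtype.ext (hfixed g r)) ?_
  · refine (injective_iff_map_eq_one _).2 fun g hg => hfaith g fun j => ?_
    exact congrArg Subtype.val (DFunLike.congr_fun hg (x' j))
  · exact (AlgHom.algebraicIndependent_iff E.val Subtype.val_injective).1 hx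
  · refine IntermediateField.map_injective E.val ?_
    rw [IntermediateField.adjoin_map, himage, ← AlgHom.fieldRange_eq_map,
      IntermediateField.fieldRange_val]
  · intro g j
    refine AlgHom.mem_span_of_mem_span_image E.val Subtype.val_injective ?_
    rw [himage]
    exact hspan g j
  · intro f hf
    obtain ⟨a, b, hb, hab⟩ := hfrac f f.2 fun g => congrArg Subtype.val (hf g)
    exact ⟨a, b, hb, Subtype.ext hab⟩

end Restrict

/-! ### Adjoining variables permuted up to constants. -/

section Permutation

/-- The action on integral vectors by permutation of the coordinates. -/
def permExponents {G I : Type*} [Group G] (π : G →* Equiv.Perm I) :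
    G →* AddMonoid.End (I → ℤ) where
  toFun g :=
    { toFun := fun m i => m ((π g)⁻¹ i)
      map_zero' := rfl
      map_add' := fun _ _ => rfl }
  map_one' := by
    ext m i
    change m ((π 1)⁻¹ i) = m i
    simp
  map_mul' g h := by
    ext m i
    change m ((π (g * h))⁻¹ i) = m ((π h)⁻¹ ((π g)⁻¹ i))
    rw [map_mul, mul_inv_rev, Equiv.Perm.mul_apply]

@[simp]
theorem permExponents_apply {G I : Type*} [Group G] (π : G →* Equiv.Perm I) (g : G)
    (m : I → ℤ) (i : I) : permExponents π g m i = m ((π g)⁻¹ i) := rfl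

variable {k L G I : Type u} [Field k] [Field L] [Algebra k L] [Group G] [Fintype I]
  {σ : G →* (L ≃ₐ[k] L)} (π : G →* Equiv.Perm I) (c : G → I → kˣ)
  (hc : ∀ g h i, c (g * h) i = c g (π h i) * c h i)

/-- The action on Laurent polynomials permuting the variables up to scalars. -/
noncomputable def MonomialAction.ofPerm : MonomialAction σ (I → ℤ) where
  perm := permExponents π
  coeff g :=
    { toFun := fun m => algebraMap k L (∏ i, c g i ^ m.toAdd i : kˣ)
      map_one' := by simp
      map_mul' := fun m n => by
        simp only [toAdd_mul, Pi.add_apply, zpow_add, Finset.prod_mul_distrib]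
        simp }
  coeff_one m := by
    have h1 : ∀ i, c 1 i = 1 := fun i => by simpa using hc 1 1 i
    simp [h1]
  coeff_mul g h m := by
    have h1 : (∏ i, c (g * h) i ^ m i : kˣ) =
        (∏ i, c g i ^ m ((π h)⁻¹ i)) * ∏ i, c h i ^ m i := by
      rw [← Equiv.prod_comp (π h) fun i => c g i ^ m ((π h)⁻¹ i), ← Finset.prod_mul_distrib]
      refine Finset.prod_congr rfl fun i _ => ?_
      rw [hc, mul_zpow, Equiv.Perm.inv_eq_iff_eq.2 rfl]
    simp only [MonoidHom.coe_mk, OneHom.coe_mk, toAdd_ofAdd, AlgEquiv.commutes, ← map_mul,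
      ← Units.val_mul, h1, permExponents_apply]

variable [DecidableEq I]

theorem MonomialAction.ofPerm_act_single (g : G) (i : I) :
    (MonomialAction.ofPerm (σ := σ) π c hc).act g (AddMonoidAlgebra.single (Pi.single i 1) 1) =
      AddMonoidAlgebra.single (Pi.single (π g i) 1) (algebraMap k L (c g i)) := by
  rw [MonomialAction.act_single, map_one, one_mul]
  congr 1
  · ext j
    simp only [MonomialAction.ofPerm, permExponents_apply, Pi.single_apply,
      Equiv.Perm.inv_eq_iff_eq]
  · change algebraMap k L (∏ j, c g j ^ (Pi.single i 1 : I → ℤ) j : kˣ) = _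
    rw [Finset.prod_eq_single i (fun j _ hj => by simp [hj]) (by simp)]
    simp

omit [DecidableEq I] in
theorem MonomialAction.ofPerm_act_const (g : G) (l : L) :
    (MonomialAction.ofPerm (σ := σ) π c hc).act g (AddMonoidAlgebra.single 0 l) =
      AddMonoidAlgebra.single 0 (σ g l) := by
  rw [MonomialAction.act_single, map_zero, ofAdd_zero, map_one, mul_one]

variable (L I) in
/-- The variables of the field of rational functions. -/
noncomputable def laurentVar (i : I) : FractionRing (AddMonoidAlgebra L (I → ℤ)) :=
  algebraMap (AddMonoidAlgebra L (I → ℤ)) _ (AddMonoidAlgebra.single (Pi.single i 1) 1)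

theorem fieldAction_laurentVar (g : G) (i : I) :
    (MonomialAction.ofPerm (σ := σ) π c hc).fieldAction g (laurentVar L I i) =
      (c g i : k) • laurentVar L I (π g i) := by
  rw [laurentVar, fractionAction_algebraMap, MonomialAction.actEquiv_apply,
    MonomialAction.ofPerm_act_single, laurentVar]
  have h1 : AddMonoidAlgebra.single (Pi.single (π g i) 1) (algebraMap k L (c g i)) =
    (c g i : k) • (AddMonoidAlgebra.single (Pi.single (π g i) 1) 1 :
      AddMonoidAlgebra L (I → ℤ)) := by simp [Algebra.smul_def]
  rw [h1]
  exact map_smul (IsScalarTower.toAlgHom k (AddMonoidAlgebra L (I → ℤ)) _) _ _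

omit [DecidableEq I] in
theorem fieldAction_algebraMap (g : G) (l : L) :
    (MonomialAction.ofPerm (σ := σ) π c hc).fieldAction g (algebraMap L _ l) =
      algebraMap L _ (σ g l) := by
  classical
  rw [IsScalarTower.algebraMap_apply L (AddMonoidAlgebra L (I → ℤ)), fractionAction_algebraMap,
    MonomialAction.actEquiv_apply, IsScalarTower.algebraMap_apply L (AddMonoidAlgebra L (I → ℤ))]
  exact congrArg _ (MonomialAction.ofPerm_act_const π c hc g l)

omit [Fintype I] in
theorem algebraicIndependent_laurentVar : AlgebraicIndependent L (laurentVar L I) :=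
  (algebraicIndependent_single L I).map'
    (f := IsScalarTower.toAlgHom L (AddMonoidAlgebra L (I → ℤ)) _)
    (IsFractionRing.injective (AddMonoidAlgebra L (I → ℤ)) _)

variable {ι : Type u} {x : ι → L}

omit [Fintype I] in
theorem algebraicIndependent_laurentVar_sumElim (hx : AlgebraicIndependent k x) :
    AlgebraicIndependent k (Sum.elim (laurentVar L I)
      (algebraMap L (FractionRing (AddMonoidAlgebra L (I → ℤ))) ∘ x)) :=
  hx.sumElim_comp algebraicIndependent_laurentVar

theorem adjoin_laurentVar_sumElim (hx : IntermediateField.adjoin k (Set.range x) = ⊤) :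
    IntermediateField.adjoin k (Set.range (Sum.elim (laurentVar L I)
      (algebraMap L (FractionRing (AddMonoidAlgebra L (I → ℤ))) ∘ x))) = ⊤ := by
  set F := FractionRing (AddMonoidAlgebra L (I → ℤ))
  set E := IntermediateField.adjoin k (Set.range (Sum.elim (laurentVar L I) (algebraMap L F ∘ x)))
  have hE : ∀ z, Sum.elim (laurentVar L I) (algebraMap L F ∘ x) z ∈ E := fun z =>
    IntermediateField.subset_adjoin k _ ⟨z, rfl⟩
  have hL : ∀ l : L, algebraMap L F l ∈ E := by
    have h1 : IntermediateField.adjoin k (Set.range x) ≤ E.comap (IsScalarTower.toAlgHom k L F) :=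
      IntermediateField.adjoin_le_iff.2 (by
        rintro _ ⟨j, rfl⟩
        exact hE (Sum.inr j))
    rw [hx] at h1
    exact fun l => h1 (x := l) trivial
  refine eq_top_iff.2 fun f _ => ?_
  have hf : f ∈ IntermediateField.adjoin L (Set.range (laurentVar L I)) := by
    have := adjoin_single_eq_top (C := L) (F := F) (I := I)
    exact this.symm ▸ trivial
  induction hf using IntermediateField.adjoin_induction with
  | mem y hy =>
    obtain ⟨i, rfl⟩ := hy
    exact hE (Sum.inl i)
  | algebraMap l => exact hL l
  | add y z _ _ h1 h2 => exact add_mem (h1 trivial) (h2 trivial)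
  | inv y _ h1 => exact inv_mem (h1 trivial)
  | mul y z _ _ h1 h2 => exact mul_mem (h1 trivial) (h2 trivial)

omit [DecidableEq I] in
-- The action stays linear because `g` sends each new variable to a constant multiple of another. An
-- automorphism fixing all new variables has trivial scalars, so `hfaith` need not mention the
-- permutation.
theorem isLinearAction_fieldAction [Finite ι] (hx : AlgebraicIndependent k x)
    (htop : IntermediateField.adjoin k (Set.range x) = ⊤)
    (hspan : ∀ g i, σ g (x i) ∈ Submodule.span k (Set.range x))
    (hfaith : ∀ g, σ g = 1 → (∀ i, c g i = 1) → g = 1) :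
    IsLinearAction (MonomialAction.ofPerm (σ := σ) π c hc).fieldAction := by
  classical
  refine ⟨(injective_iff_map_eq_one _).2 fun g hg => ?_, I ⊕ ι, inferInstance,
    _, algebraicIndependent_laurentVar_sumElim hx, adjoin_laurentVar_sumElim htop, ?_⟩
  · refine hfaith g (AlgEquiv.ext fun l => ?_) fun i => ?_
    · have h1 := fieldAction_algebraMap π c hc (σ := σ) g l
      rw [hg] at h1
      exact ((algebraMap L _).injective h1).symm
    · have h1 := MonomialAction.ofPerm_act_single π c hc (σ := σ) g i
      have h2 : (MonomialAction.ofPerm (σ := σ) π c hc).fieldAction g (laurentVar L I i) =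
        laurentVar L I i := by rw [hg]; rfl
      rw [laurentVar, fractionAction_algebraMap, MonomialAction.actEquiv_apply, h1] at h2
      have h3 := IsFractionRing.injective (AddMonoidAlgebra L (I → ℤ)) _ h2
      have h4 := congrArg (fun f => AddMonoidAlgebra.coeff f (Pi.single (π g i) 1)) h3
      simp only [AddMonoidAlgebra.coeff_single, Finsupp.single_eq_same, Finsupp.single_apply] at h4
      split_ifs at h4
      · exact Units.ext ((algebraMap k L).injective (by simpa using h4))
      · simp at h4
  · rintro g (i | j)
    · rw [Sum.elim_inl, fieldAction_laurentVar]
      exact Submodule.smul_mem _ _ (Submodule.subset_span ⟨Sum.inl _, rfl⟩)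
    · rw [Sum.elim_inr, Function.comp_apply, fieldAction_algebraMap]
      have h1 : Submodule.span k (Set.range x) ≤ (Submodule.span k (Set.range (Sum.elim
          (laurentVar L I)
          (algebraMap L (FractionRing (AddMonoidAlgebra L (I → ℤ))) ∘ x)))).comap
          (IsScalarTower.toAlgHom k L _).toLinearMap := by
        rw [Submodule.span_le]
        rintro _ ⟨j, rfl⟩
        exact Submodule.subset_span ⟨Sum.inr j, rfl⟩
      exact h1 (hspan g j)

end Permutation

/-! ### Passing to a quotient by an abelian kernel. -/

section AbelianKernel

/-- Left translation on the first factor of a product. -/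
def leftMulPerm (G X : Type*) [Group G] : G →* Equiv.Perm (G × X) where
  toFun g := (Equiv.mulLeft g).prodCongr (Equiv.refl X)
  map_one' := by ext <;> simp
  map_mul' g h := by ext <;> simp [mul_assoc]

/-- Linear quotients by a quotient group with abelian kernel are dominated by linear quotients by
the group itself. -/
theorem HasLinearTowers.of_surjective {k G Γ : Type u} [Field k] [IsAlgClosed k] [CharZero k]
    [Group G] [Finite G] [Group Γ] [Finite Γ] (q : Γ →* G) (hq : Function.Surjective q)
    (hker : ∀ a b, q a = 1 → q b = 1 → a * b = b * a) (h : HasLinearTowers k Γ) :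
    HasLinearTowers k G := by
  intro Ω _ _ σ hσ
  obtain ⟨ι, _, x, hx, htop, hspan⟩ := hσ.exists_generators
  let _ : CommGroup q.ker :=
    { (inferInstance : Group q.ker) with
      mul_comm := fun a b => Subtype.ext (hker a b a.2 b.2) }
  have : NeZero (Monoid.exponent q.ker) := ⟨Monoid.exponent_ne_zero_of_finite⟩
  have : NeZero (Monoid.exponent q.ker : k) := ⟨Nat.cast_ne_zero.2 (NeZero.ne _)⟩
  have : Finite (q.ker →* kˣ) := by
    obtain ⟨e⟩ := CommGroup.monoidHom_mulEquiv_of_hasEnoughRootsOfUnity q.ker k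
    exact Finite.of_equiv _ e.symm.toEquiv
  -- The new variables are coordinates on the sum, over all characters of the kernel, of the induced
  -- representations of `Γ`. With the section `s`, the scalars are the characters evaluated on `a`.
  let I := G × (q.ker →* kˣ)
  have := Fintype.ofFinite I
  let s := Function.surjInv hq
  have hs : ∀ g, q (s g) = g := Function.surjInv_eq hq
  let a : Γ → G → q.ker := fun γ g => ⟨(s (q γ * g))⁻¹ * γ * s g, by simp [MonoidHom.mem_ker, hs]⟩
  have ha : ∀ γ δ g, a (γ * δ) g = a γ (q δ * g) * a δ g := fun γ δ g => Subtype.ext <| by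
    simp [a, mul_assoc]
  let c : Γ → I → kˣ := fun γ i => i.2 (a γ i.1)
  let π := leftMulPerm G (q.ker →* kˣ)
  have hc : ∀ γ δ i, c (γ * δ) i = c γ ((π.comp q) δ i) * c δ i := fun γ δ i => by
    simp only [c, ha, map_mul]
    rfl
  refine MonomialAction.quotientHasTower hq hσ.injective
    (MonomialAction.ofPerm (σ := σ.comp q) (π.comp q) c hc) (p := permExponents π)
    (fun _ _ => rfl) (h _ _ (isLinearAction_fieldAction _ c hc hx htop (fun γ => hspan (q γ)) ?_))
  intro γ hγ hcγ
  have hqγ : q γ = 1 := hσ.injective (hγ.trans (map_one σ).symm)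
  -- An element acting trivially lies in the kernel, where `a γ 1` is a conjugate of `γ`. Characters
  -- of a finite abelian group separate points.
  have h1 : a γ 1 = 1 := by
    by_contra h1
    obtain ⟨χ, hχ⟩ := CommGroup.exists_apply_ne_one_of_hasEnoughRootsOfUnity q.ker k h1
    exact hχ (hcγ (1, χ))
  have h2 : (s 1)⁻¹ * γ * s 1 = 1 := by simpa [a, hqγ] using congrArg Subtype.val h1
  rwa [mul_eq_one_iff_eq_inv, inv_mul_eq_iff_eq_mul, mul_inv_cancel] at h2

end AbelianKernel

/-! ### The no-name lemma. -/

section NoName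

/-- A finite-dimensional space with semilinear action of a finite group is spanned by at most
as many invariant vectors as its dimension. -/
theorem exists_invariant_spanning {k Ω G : Type u} [Field k] [Field Ω] [Algebra k Ω] [Group G]
    [Finite G] (τ : G →* (Ω ≃ₐ[k] Ω)) (E : IntermediateField k Ω)
    (hE : ∀ g, ∀ e ∈ E, τ g e ∈ E) (hfaith : ∀ g, (∀ e ∈ E, τ g e = e) → g = 1)
    {ι : Type u} [Fintype ι] (x : ι → Ω)
    (hx : ∀ g i, τ g (x i) ∈ Submodule.span k (Set.range x)) :
    ∃ (κ : Type u) (_ : Finite κ) (v : κ → Ω), Cardinal.mk κ ≤ Cardinal.mk ι ∧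
      (∀ g j, τ g (v j) = v j) ∧ ∀ i, x i ∈ Submodule.span E (Set.range v) := by
  classical
  have := Fintype.ofFinite G
  obtain ⟨n, a, b, h1, h2⟩ := exists_dual_family (E.restrictAction τ hE) <|
    (injective_iff_map_eq_one _).2 fun g hg => hfaith g fun e he =>
      congrArg Subtype.val (DFunLike.congr_fun hg (⟨e, he⟩ : E))
  let X := Submodule.span E (Set.range x)
  have hX : ∀ g i, τ g (x i) ∈ X := fun g i =>
    Submodule.span_le_restrictScalars k E _ (hx g i)
  let S : Set Ω := {v | v ∈ X ∧ ∀ g, τ g v = v}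
  have hxS : ∀ i, x i ∈ Submodule.span E S := by
    intro i
    -- The dual family of `E` expresses `x i` through traces, which are invariant vectors.
    have h3 : x i = ∑ j, b j • ∑ g, τ g ((a j : Ω) * x i) := by
      simp only [map_mul, Finset.smul_sum]
      rw [Finset.sum_comm, Finset.sum_eq_single 1]
      · simp only [map_one, AlgEquiv.one_apply, Algebra.smul_def, ← mul_assoc]
        rw [← Finset.sum_mul]
        have h4 := congrArg (algebraMap E Ω) h1
        simp only [map_sum, map_mul, map_one] at h4
        exact ((congrArg (· * x i) h4).trans (one_mul _)).symm
      · intro g _ hg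
        simp only [Algebra.smul_def, ← mul_assoc]
        rw [← Finset.sum_mul]
        have h4 := congrArg (algebraMap E Ω) (h2 g hg)
        simp only [map_sum, map_mul, map_zero] at h4
        exact (congrArg (· * τ g (x i)) h4).trans (zero_mul _)
      · simp
    rw [h3]
    refine Submodule.sum_mem _ fun j _ => Submodule.smul_mem _ _ (Submodule.subset_span ⟨?_, ?_⟩)
    · refine Submodule.sum_mem _ fun g _ => ?_
      rw [map_mul]
      exact X.smul_mem (⟨τ g (a j), hE g _ (a j).2⟩ : E) (hX g i)
    · intro h
      rw [map_sum, ← Equiv.sum_comp (Equiv.mulLeft h) fun g => τ g _]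
      simp
  obtain ⟨t, htS, hspan, hli⟩ := exists_linearIndependent E S
  -- The chosen invariant vectors are independent in the span of the `x i`, which bounds their
  -- number. Equality of transcendence degrees later rests on this bound.
  have hle := linearIndependent_le_span' _ hli (Set.range x) (by
    rintro _ ⟨v, rfl⟩
    exact (htS v.2).1)
  have hle2 : Cardinal.mk t ≤ Cardinal.mk ι := by
    refine hle.trans ?_
    rw [Cardinal.mk_fintype]
    exact_mod_cast Fintype.card_range_le x
  have : Finite t := by
    rw [← Cardinal.lt_aleph0_iff_finite]
    exact hle2.trans_lt (Cardinal.lt_aleph0_of_finite ι)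
  refine ⟨t, this, (↑), hle2, fun g v => (htS v.2).2 g, fun i => ?_⟩
  rw [Subtype.range_coe, hspan]
  exact hxS i

end NoName

/-! ### Invariants of diagonal roots of unity. -/

section Kummer

/-- The fixed field of a group of diagonal automorphisms `y i ↦ a i • y i`. -/
theorem mem_of_diagonal_fixed {k Ω I : Type u} [Field k] [IsAlgClosed k] [CharZero k] [Field Ω]
    [Algebra k Ω] [Finite I] {m : ℕ} [NeZero m]
    (α : (I → rootsOfUnity m k) →* (Ω ≃ₐ[k] Ω)) (y : I → Ω)
    (hy : ∀ a i, α a (y i) = ((a i : kˣ) : k) • y i)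
    (E : IntermediateField k Ω) (hE : ∀ a, ∀ e ∈ E, α a e = e) (hym : ∀ i, y i ^ m ∈ E)
    (htop : IntermediateField.adjoin E (Set.range y) = ⊤) (f : Ω) (hf : ∀ a, α a f = f) :
    f ∈ E := by
  classical
  have := Fintype.ofFinite I
  have := Fintype.ofFinite (I → rootsOfUnity m k)
  have hint : ∀ z ∈ Set.range y, IsIntegral E z := by
    rintro _ ⟨i, rfl⟩
    refine IsIntegral.of_pow (NeZero.pos m) ?_
    exact isIntegral_algebraMap (R := E) (x := (⟨_, hym i⟩ : E))
  obtain ⟨p, hp⟩ : ∃ p : MvPolynomial I E, MvPolynomial.aeval y p = f := by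
    have h1 := IntermediateField.adjoin_toSubalgebra_of_isAlgebraic
      (fun z hz => (hint z hz).isAlgebraic)
    rw [htop, Algebra.adjoin_range_eq_range_aeval] at h1
    have h2 : f ∈ (⊤ : IntermediateField E Ω).toSubalgebra := trivial
    rw [h1] at h2
    exact h2
  -- A monomial with all exponents divisible by `m` lies in `E`. Otherwise some diagonal element
  -- scales it by a root of unity other than one, and its sum over the group vanishes.
  have hmon : ∀ d : I →₀ ℕ, ∑ a, α a (∏ i, y i ^ d i) ∈ E := by
    intro d
    have hact : ∀ a, α a (∏ i, y i ^ d i) = (∏ i, ((a i : kˣ) : k) ^ d i) • ∏ i, y i ^ d i := by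
      intro a
      simp only [map_prod, map_pow, hy, Algebra.smul_def, mul_pow,
        Finset.prod_mul_distrib]
    by_cases hd : ∀ i, m ∣ d i
    · refine sum_mem fun a _ => ?_
      rw [hact]
      refine E.smul_mem (prod_mem fun i _ => ?_)
      obtain ⟨e, he⟩ := hd i
      rw [he, pow_mul]
      exact pow_mem (hym i) e
    · push Not at hd
      obtain ⟨i, hi⟩ := hd
      obtain ⟨ζ, hζ⟩ := HasEnoughRootsOfUnity.exists_primitiveRoot k m
      let z : rootsOfUnity m k := hζ.toRootsOfUnity
      let b : I → rootsOfUnity m k := Pi.mulSingle i z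
      have hb : ∏ j, ((b j : kˣ) : k) ^ d j = ζ ^ d i := by
        rw [Finset.prod_eq_single i (fun j _ hj => by simp [b, hj]) (by simp)]
        simp [b, z]
      have hne : ζ ^ d i ≠ 1 := fun h => hi (hζ.dvd_of_pow_eq_one _ h)
      have hfix : ζ ^ d i • ∑ a, α a (∏ i, y i ^ d i) = ∑ a, α a (∏ i, y i ^ d i) := by
        conv_rhs => rw [← Equiv.sum_comp (Equiv.mulRight b)]
        rw [Finset.smul_sum]
        refine Finset.sum_congr rfl fun a _ => ?_
        rw [Equiv.coe_mulRight, map_mul, AlgEquiv.mul_apply, hact b, hb, map_smul]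
      have h0 : ∑ a, α a (∏ i, y i ^ d i) = 0 := by
        have h1 : (ζ ^ d i - 1) • ∑ a, α a (∏ i, y i ^ d i) = 0 := by
          rw [sub_smul, hfix, one_smul, sub_self]
        exact (smul_eq_zero.1 h1).resolve_left (sub_ne_zero.2 hne)
      rw [h0]
      exact zero_mem _
  -- For invariant `f` this sum is the group order times `f`, and the order is invertible in
  -- characteristic zero.
  have hsum : ∑ a, α a f ∈ E := by
    rw [← hp, MvPolynomial.aeval_def, MvPolynomial.eval₂_eq']
    simp only [map_sum, map_mul]
    rw [Finset.sum_comm]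
    refine sum_mem fun d _ => ?_
    have h1 : ∀ a, α a (algebraMap E Ω (MvPolynomial.coeff d p)) =
      algebraMap E Ω (MvPolynomial.coeff d p) := fun a => hE a _ (MvPolynomial.coeff d p).2
    simp only [h1]
    rw [← Finset.mul_sum]
    exact mul_mem (MvPolynomial.coeff d p).2 (hmon d)
  simp only [hf, Finset.sum_const, nsmul_eq_mul] at hsum
  have : CharZero Ω := charZero_of_injective_algebraMap (algebraMap k Ω).injective
  have hne : ((Finset.univ : Finset (I → rootsOfUnity m k)).card : Ω) ≠ 0 :=
    Nat.cast_ne_zero.2 (Finset.card_ne_zero.2 ⟨1, Finset.mem_univ _⟩)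
  have h2 := mul_mem (inv_mem (natCast_mem E (Finset.univ : Finset (I → rootsOfUnity m k)).card))
    hsum
  rwa [inv_mul_cancel_left₀ hne] at h2

end Kummer

/-! ### Reducing a wreath-type product to its complement. -/

section Wreath

/-- The action on functions by permutation of the arguments. -/
def permFunctions {H I : Type*} [Group H] (π : H →* Equiv.Perm I) (X : Type*) [Group X] :
    H →* MulAut (I → X) where
  toFun h :=
    { toFun := fun a i => a ((π h)⁻¹ i)
      invFun := fun a i => a (π h i)
      left_inv := fun a => by ext; simp
      right_inv := fun a => by ext; simp
      map_mul' := fun _ _ => rfl }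
  map_one' := by
    ext a i
    change a ((π 1)⁻¹ i) = a i
    simp
  map_mul' g h := by
    ext a i
    change a ((π (g * h))⁻¹ i) = a ((π h)⁻¹ ((π g)⁻¹ i))
    rw [map_mul, mul_inv_rev, Equiv.Perm.mul_apply]

@[simp]
theorem permFunctions_apply {H I : Type*} [Group H] (π : H →* Equiv.Perm I) {X : Type*} [Group X]
    (h : H) (a : I → X) (i : I) : permFunctions π X h a i = a ((π h)⁻¹ i) := rfl

theorem IntermediateField.map_eq_of_mem_adjoin {k Ω : Type*} [Field k] [Field Ω] [Algebra k Ω]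
    {σ : Ω →ₐ[k] Ω} {S : Set Ω} (hS : ∀ s ∈ S, σ s = s) {x : Ω}
    (hx : x ∈ IntermediateField.adjoin k S) : σ x = x := by
  induction hx using IntermediateField.adjoin_induction with
  | mem y hy => exact hS y hy
  | algebraMap l => exact σ.commutes l
  | add y z _ _ h1 h2 => rw [map_add, h1, h2]
  | inv y _ h1 => rw [map_inv₀, h1]
  | mul y z _ _ h1 h2 => rw [map_mul, h1, h2]

variable {k H I : Type u} [Field k] [IsAlgClosed k] [CharZero k] [Group H] [Finite H] [Finite I]
  (m : ℕ) [NeZero m] (π : H →* Equiv.Perm I)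

/-- The group acts faithfully on `k(y, w)`, so the `x j` can be traded for invariants `v`. The fixed
field of `μ_m^I` is then `k(y ^ m, w, v)`, still purely transcendental. On it `H` permutes the
generators, faithfully because of the regular part `w`. -/
theorem HasLinearTowers.quotientHasTower_wreath (hH : HasLinearTowers k H) {Ω : Type u} [Field Ω]
    [Algebra k Ω]
    (τ : (I → rootsOfUnity m k) ⋊[permFunctions π _] H →* (Ω ≃ₐ[k] Ω)) {ι : Type u} [Finite ι]
    (y : I → Ω) (w : H → Ω) (x : ι → Ω)
    (hind : AlgebraicIndependent k (Sum.elim (Sum.elim y w) x))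
    (htop : IntermediateField.adjoin k (Set.range (Sum.elim (Sum.elim y w) x)) = ⊤)
    (hy : ∀ g i, τ g (y i) = ((g.left (π g.right i) : kˣ) : k) • y (π g.right i))
    (hw : ∀ g h, τ g (w h) = w (g.right * h))
    (hx : ∀ g j, τ g (x j) ∈ Submodule.span k (Set.range x)) : QuotientHasTower τ := by
  classical
  have := Fintype.ofFinite ι
  have := Fintype.ofFinite I
  have := Fintype.ofFinite H
  have : Finite ((I → rootsOfUnity m k) ⋊[permFunctions π _] H) :=
    Finite.of_equiv _ SemidirectProduct.equivProd.symm
  have hw_inj : Function.Injective w := fun g h hgh =>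
    Sum.inr_injective (Sum.inl_injective (hind.injective (a₁ := Sum.inl (Sum.inr g))
      (a₂ := Sum.inl (Sum.inr h)) hgh))
  have hy_ne : ∀ i, y i ≠ 0 := fun i => hind.ne_zero (Sum.inl (Sum.inl i))
  let α := τ.comp SemidirectProduct.inl
  let η := τ.comp SemidirectProduct.inr
  let E₂ := IntermediateField.adjoin k (Set.range (Sum.elim y w))
  have hE₂ : ∀ g, ∀ e ∈ E₂, τ g e ∈ E₂ := fun g e he =>
    IntermediateField.map_mem_adjoin (σ := (τ g : Ω →ₐ[k] Ω)) (by
      rintro _ ⟨i | h, rfl⟩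
      · refine (hy g i).symm ▸ E₂.smul_mem ?_
        exact IntermediateField.subset_adjoin k _ ⟨Sum.inl _, rfl⟩
      · refine (hw g h).symm ▸ ?_
        exact IntermediateField.subset_adjoin k _ ⟨Sum.inr _, rfl⟩) he
  have hfaith : ∀ g, (∀ e ∈ E₂, τ g e = e) → g = 1 := by
    intro g hg
    have h1 : g.right = 1 := by
      have h2 := hg (w 1) (IntermediateField.subset_adjoin k _ ⟨Sum.inr 1, rfl⟩)
      rw [hw] at h2
      simpa using hw_inj h2
    refine SemidirectProduct.ext (funext fun i => ?_) h1
    have h2 := hg (y i) (IntermediateField.subset_adjoin k _ ⟨Sum.inl i, rfl⟩)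
    rw [hy, h1, map_one, Equiv.Perm.one_apply] at h2
    have h3 := smul_left_injective k (hy_ne i) (h2.trans (one_smul k (y i)).symm)
    exact Subtype.ext (Units.ext h3)
  obtain ⟨κ, _, v, hcard, hv, hxv⟩ := exists_invariant_spanning τ E₂ hE₂ hfaith x hx
  let z : (I ⊕ H) ⊕ κ → Ω := Sum.elim (Sum.elim (fun i => y i ^ m) w) v
  let E := IntermediateField.adjoin k (Set.range z)
  have hzE : ∀ j, z j ∈ E := fun j => IntermediateField.subset_adjoin k _ ⟨j, rfl⟩
  -- Adjoining `y` to `E` recovers `k(y, w)`, hence every `x j` as a `k(y, w)`-combination of the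
  -- invariants `v`.
  have htopE : IntermediateField.adjoin E (Set.range y) = ⊤ := by
    refine eq_top_iff.2 fun f _ => ?_
    let T := (IntermediateField.adjoin E (Set.range y)).restrictScalars k
    have hET : ∀ e ∈ E, e ∈ T := fun e he =>
      (IntermediateField.adjoin E (Set.range y)).algebraMap_mem ⟨e, he⟩
    have hyT : ∀ i, y i ∈ T := fun i => IntermediateField.subset_adjoin E _ ⟨i, rfl⟩
    have hwT : ∀ h, w h ∈ T := fun h => hET _ (hzE (Sum.inl (Sum.inr h)))
    have hE₂T : E₂ ≤ T := IntermediateField.adjoin_le_iff.2 (by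
      rintro _ ⟨i | h, rfl⟩
      exacts [hyT i, hwT h])
    have hxT : ∀ j, x j ∈ T := fun j => by
      refine Submodule.span_induction (p := fun e _ => e ∈ T) ?_ (zero_mem T)
        (fun _ _ _ _ h1 h2 => add_mem h1 h2)
        (fun a _ _ h1 => mul_mem (hE₂T a.2) h1) (hxv j)
      rintro _ ⟨j, rfl⟩
      exact hET _ (hzE (Sum.inr j))
    have hT : IntermediateField.adjoin k (Set.range (Sum.elim (Sum.elim y w) x)) ≤ T :=
      IntermediateField.adjoin_le_iff.2 (by
        rintro _ ⟨(i | h) | j, rfl⟩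
        exacts [hyT i, hwT h, hxT j])
    rw [htop] at hT
    exact hT (x := f) trivial
  have halg : Algebra.IsAlgebraic E Ω := by
    have h1 := IntermediateField.isAlgebraic_adjoin (K := E) (S := Set.range y) (by
      rintro _ ⟨i, rfl⟩
      refine IsIntegral.of_pow (NeZero.pos m) ?_
      exact isIntegral_algebraMap (R := E) (x := (⟨_, hzE (Sum.inl (Sum.inl i))⟩ : E)))
    refine ⟨fun f => ?_⟩
    have hf : f ∈ IntermediateField.adjoin E (Set.range y) := htopE.symm ▸ trivial
    exact IntermediateField.isAlgebraic_iff.1 (h1.isAlgebraic ⟨f, hf⟩)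
  -- `Ω` is algebraic over `k(z)`, and `z` has no more members than the original independent family,
  -- so `z` is a transcendence basis.
  have hzind : AlgebraicIndependent k z := by
    have := IntermediateField.isAlgebraic_adjoin_iff_top.1 halg
    refine (Algebra.IsAlgebraic.isTranscendenceBasis_of_le_trdeg_of_finite k z ?_).1
    refine le_trans ?_ hind.cardinalMk_le_trdeg
    rw [Cardinal.mk_sum, Cardinal.mk_sum ((I ⊕ H)) ι]
    simp only [Cardinal.lift_id]
    exact add_le_add le_rfl hcard
  have hαE : ∀ a, ∀ e ∈ E, α a e = e := fun a e he =>
    IntermediateField.map_eq_of_mem_adjoin (σ := (α a : Ω →ₐ[k] Ω)) (by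
      rintro _ ⟨(i | h) | j, rfl⟩
      · change τ _ (y i ^ m) = y i ^ m
        rw [map_pow, hy]
        simp only [SemidirectProduct.right_inl, map_one, Equiv.Perm.one_apply,
          SemidirectProduct.left_inl, Algebra.smul_def, mul_pow, ← map_pow, ← Units.val_pow_eq_pow_val]
        rw [(mem_rootsOfUnity _ _).1 (a i).2]
        simp
      · change τ _ (w h) = w h
        rw [hw]
        simp
      · exact hv _ j) he
  intro R _ _ _ _ i hi hfixed hfrac
  refine hH.of_adjoin η z hzind ?_ ?_ R i hi ?_ (fun g => hfixed _) ?_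
  · rintro g ((i | h) | j)
    · refine Submodule.subset_span ⟨Sum.inl (Sum.inl (π g i)), ?_⟩
      change y (π g i) ^ m = τ _ (y i ^ m)
      rw [map_pow, hy]
      simp
    · refine Submodule.subset_span ⟨Sum.inl (Sum.inr (g * h)), ?_⟩
      exact (hw (SemidirectProduct.inr g) h).symm
    · exact Submodule.subset_span ⟨Sum.inr j, (hv _ j).symm⟩
  · intro g hg
    have h1 := (hw (SemidirectProduct.inr g) 1).symm.trans (hg (Sum.inl (Sum.inr 1)))
    simpa using hw_inj h1
  · intro r
    refine mem_of_diagonal_fixed α y (fun a i => ?_) E hαE (fun i => hzE (Sum.inl (Sum.inl i)))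
      htopE _ fun a => hfixed _ r
    refine (hy _ i).trans ?_
    simp
  · intro f hf hηf
    refine hfrac f fun g => ?_
    have h1 : τ g f = α g.left (η g.right f) := by
      conv_lhs => rw [← SemidirectProduct.inl_left_mul_inr_right g, map_mul]
      rfl
    rw [h1, hηf, hαE _ f hf]

/-- One monomial step adjoins the variables `y` and `w` required by `quotientHasTower_wreath` to an
arbitrary linear action. -/
theorem HasLinearTowers.wreath (hH : HasLinearTowers k H) :
    HasLinearTowers k ((I → rootsOfUnity m k) ⋊[permFunctions π _] H) := by
  intro Ω _ _ σ hσ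
  classical
  obtain ⟨ι, _, x, hx, htop, hspan⟩ := hσ.exists_generators
  have := Fintype.ofFinite I
  have := Fintype.ofFinite H
  have : Finite ((I → rootsOfUnity m k) ⋊[permFunctions π _] H) :=
    Finite.of_equiv _ SemidirectProduct.equivProd.symm
  let πJ : (I → rootsOfUnity m k) ⋊[permFunctions π _] H →* Equiv.Perm (I ⊕ H) :=
    ((Equiv.Perm.sumCongrHom I H).comp (π.prod (MulAction.toPermHom H H))).comp
      SemidirectProduct.rightHom
  let c : (I → rootsOfUnity m k) ⋊[permFunctions π _] H → I ⊕ H → kˣ := fun g =>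
    Sum.elim (fun i => g.left (π g.right i)) 1
  have hc : ∀ g h j, c (g * h) j = c g (πJ h j) * c h j := by
    rintro g h (i | i)
    · simp [c, πJ]
    · simp [c, πJ]
  -- No change of group is needed here, so `q` is the identity.
  let w := MonomialAction.ofPerm (σ := σ.comp (MonoidHom.id _)) πJ c hc
  refine w.quotientHasTower (q := MonoidHom.id _) Function.surjective_id hσ.injective
    (p := permExponents πJ) (fun _ _ => rfl) ?_
  have helim : Sum.elim (Sum.elim (fun i => laurentVar Ω (I ⊕ H) (Sum.inl i))
      fun h => laurentVar Ω (I ⊕ H) (Sum.inr h))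
      (algebraMap Ω (FractionRing (AddMonoidAlgebra Ω (I ⊕ H → ℤ))) ∘ x) =
      Sum.elim (laurentVar Ω (I ⊕ H)) (algebraMap Ω _ ∘ x) := by
    rw [← Sum.elim_comp_inl_inr (laurentVar Ω (I ⊕ H))]
    rfl
  refine hH.quotientHasTower_wreath m π w.fieldAction
    (fun i => laurentVar Ω (I ⊕ H) (Sum.inl i)) (fun h => laurentVar Ω (I ⊕ H) (Sum.inr h))
    (algebraMap Ω _ ∘ x) ?_ ?_ (fun g i => ?_) (fun g h => ?_) (fun g j => ?_)
  · rw [helim]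
    exact algebraicIndependent_laurentVar_sumElim hx
  · rw [helim]
    exact adjoin_laurentVar_sumElim htop
  · exact fieldAction_laurentVar πJ c hc g (Sum.inl i)
  · exact (fieldAction_laurentVar πJ c hc g (Sum.inr h)).trans (one_smul _ _)
  · rw [Function.comp_apply, fieldAction_algebraMap πJ c hc, Set.range_comp]
    exact Submodule.apply_mem_span_image_of_mem_span
      (IsScalarTower.toAlgHom k Ω (FractionRing (AddMonoidAlgebra Ω (I ⊕ H → ℤ)))).toLinearMap
      (hspan g j)

end Wreath

/-! ### Group theory: induction over groups of class at most two. -/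

section Groups

variable {k : Type u} [Field k] [IsAlgClosed k] [CharZero k]

omit [IsAlgClosed k] [CharZero k] in
theorem hasLinearTowers_of_subsingleton (G : Type u) [Group G] [Subsingleton G] :
    HasLinearTowers k G := by
  intro Ω _ _ σ hσ R _ _ _ _ i hi _ hfrac
  obtain ⟨ι, _, x, hx, htop, -⟩ := hσ.exists_generators
  let e := Finite.equivFin ι
  refine .base _ (isRational_of_algebraicIndependent i hi (fun f => hfrac f fun g => ?_)
    (x ∘ e.symm) (hx.comp _ e.symm.injective) ?_)
  · rw [Subsingleton.elim g 1, map_one, AlgEquiv.one_apply]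
  · rw [EquivLike.range_comp, htop]

/-- A group that is the product of an abelian normal subgroup and a subgroup all of whose linear
quotients have towers. -/
theorem HasLinearTowers.of_sup_eq_top {G : Type u} [Group G] [Finite G] (N H : Subgroup G)
    [N.Normal] (hN : ∀ a ∈ N, ∀ b ∈ N, a * b = b * a) (hNH : N ⊔ H = ⊤)
    (hH : HasLinearTowers k H) : HasLinearTowers k G := by
  classical
  let _ : CommGroup N :=
    { (inferInstance : Group N) with
      mul_comm := fun a b => Subtype.ext (hN a a.2 b b.2) }
  have := Fintype.ofFinite N
  let m := Nat.card N
  have : NeZero m := ⟨Nat.card_pos.ne'⟩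
  -- The group `μ_m` is cyclic of order `m = |N|`, so for each `n` some homomorphism to `N` sends
  -- its generator `z` to `n`. Their product `Φ` maps `μ_m^N` onto `N`, equivariantly for
  -- conjugation by `H`.
  obtain ⟨z, hz⟩ := IsCyclic.exists_generator (α := rootsOfUnity m k)
  have hzord : orderOf z = m := by
    rw [orderOf_eq_card_of_forall_mem_zpowers hz, HasEnoughRootsOfUnity.natCard_rootsOfUnity]
  have hdvd : ∀ n : N, orderOf n ∣ orderOf z := fun n => by
    rw [hzord]
    exact orderOf_dvd_natCard n
  let φ : N → rootsOfUnity m k →* N := fun n => monoidHomOfForallMemZpowers hz (hdvd n)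
  have hφ : ∀ n, φ n z = n := fun n => monoidHomOfForallMemZpowers_apply_gen hz (hdvd n)
  have hφ_conj : ∀ (f : MulAut N) n a, φ (f n) a = f (φ n a) := fun f n a => by
    obtain ⟨j, rfl⟩ := Subgroup.mem_zpowers_iff.1 (hz a)
    rw [map_zpow, map_zpow, map_zpow, hφ, hφ]
  let conj : H →* MulAut N := MulAut.conjNormal.comp H.subtype
  let π : H →* Equiv.Perm N := (MulAut.toPerm N).comp conj
  let Φ : (N → rootsOfUnity m k) →* N := ∏ n, (φ n).comp (Pi.evalMonoidHom _ n)
  have hΦ : ∀ a, Φ a = ∏ n, φ n (a n) := fun a => by simp [Φ, MonoidHom.finsetProd_apply]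
  have hΦ_conj : ∀ h a, Φ (permFunctions π _ h a) = conj h (Φ a) := fun h a => by
    rw [hΦ, hΦ, map_prod, ← Equiv.prod_comp (π h)]
    refine Finset.prod_congr rfl fun n _ => ?_
    rw [permFunctions_apply, Equiv.Perm.inv_eq_iff_eq.2 rfl]
    exact hφ_conj (conj h) n (a n)
  let q : (N → rootsOfUnity m k) ⋊[permFunctions π _] H →* G :=
    SemidirectProduct.lift (N.subtype.comp Φ) H.subtype fun h => MonoidHom.ext fun a => by
      change ((Φ (permFunctions π _ h a) : N) : G) = h * Φ a * (h : G)⁻¹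
      rw [hΦ_conj]
      rfl
  have hq : ∀ g, q g = (Φ g.left : G) * g.right := fun g => rfl
  have : Finite ((N → rootsOfUnity m k) ⋊[permFunctions π _] H) :=
    Finite.of_equiv _ SemidirectProduct.equivProd.symm
  refine (hH.wreath m π).of_surjective q ?_ ?_
  · rw [← MonoidHom.range_eq_top, eq_top_iff, ← hNH, sup_le_iff]
    constructor
    · intro n hn
      refine ⟨SemidirectProduct.inl (Pi.mulSingle ⟨n, hn⟩ z), ?_⟩
      have h1 : Φ (Pi.mulSingle ⟨n, hn⟩ z) = ⟨n, hn⟩ := by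
        rw [hΦ, Finset.prod_eq_single ⟨n, hn⟩ (fun j _ hj => by simp [hj]) (by simp)]
        simp [hφ]
      rw [hq]
      simp [h1]
    · intro h hh
      exact ⟨SemidirectProduct.inr ⟨h, hh⟩, by simp [hq]⟩
  -- A kernel element has its `H`-component in `N`. As `N` is abelian, that component acts trivially
  -- on `N` and on the indices, and the components of two kernel elements commute.
  · have hmem : ∀ g, q g = 1 → (g.right : G) ∈ N := fun g hg => by
      rw [hq] at hg
      rw [eq_inv_of_mul_eq_one_right hg]
      exact inv_mem (Φ g.left).2
    have hperm : ∀ g, q g = 1 → π g.right = 1 := fun g hg => Equiv.ext fun n => Subtype.ext <| by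
      change (g.right : G) * n * (g.right : G)⁻¹ = n
      rw [hN _ (hmem g hg) _ n.2, mul_inv_cancel_right]
    have hact : ∀ g, q g = 1 → permFunctions π (rootsOfUnity m k) g.right = 1 := fun g hg => by
      ext a i : 2
      rw [permFunctions_apply, hperm g hg]
      rfl
    intro a b ha hb
    refine SemidirectProduct.ext ?_ (Subtype.ext (hN _ (hmem a ha) _ (hmem b hb)))
    rw [SemidirectProduct.mul_left, SemidirectProduct.mul_left, hact a ha, hact b hb]
    exact mul_comm _ _

/-- Linear quotients by groups of nilpotency class at most two have towers. -/
theorem hasLinearTowers_of_commutator_le_center (G : Type u) [Group G] [Finite G]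
    (hG : ∀ a b : G, a * b * a⁻¹ * b⁻¹ ∈ Subgroup.center G) : HasLinearTowers k G := by
  induction h : Nat.card G using Nat.strong_induction_on generalizing G with
  | _ n ih =>
    subst h
    cases subsingleton_or_nontrivial G with
    | inl _ => exact hasLinearTowers_of_subsingleton G
    | inr _ =>
      -- Any maximal subgroup serves as `H`.
      obtain h | ⟨H, hH, -⟩ := eq_top_or_exists_le_coatom (⊥ : Subgroup G)
      · exact absurd h bot_ne_top
      obtain ⟨g, hg⟩ : ∃ g, g ∉ H := by
        by_contra! h
        exact hH.1 (eq_top_iff.2 fun g _ => h g)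
      -- One element together with the center generates an abelian subgroup. It is normal because it
      -- contains every commutator, and with `H` it generates `G` by maximality of `H`.
      let N := Subgroup.zpowers g ⊔ Subgroup.center G
      have hN : ∀ a ∈ N, ∀ b ∈ N, a * b = b * a := by
        intro a ha b hb
        obtain ⟨_, ⟨i, rfl⟩, y, hy, rfl⟩ := Subgroup.mem_sup_of_normal_right.1 ha
        obtain ⟨_, ⟨j, rfl⟩, z, hz, rfl⟩ := Subgroup.mem_sup_of_normal_right.1 hb
        have h1 := Subgroup.mem_center_iff.1 hy
        have h2 := Subgroup.mem_center_iff.1 hz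
        have h3 : Commute (g ^ i * y) (g ^ j * z) :=
          ((Commute.zpow_zpow_self g i j).mul_right (h2 _)).mul_left
            ((h1 _).symm : y * (g ^ j * z) = g ^ j * z * y)
        exact h3
      have : N.Normal := ⟨fun n hn x => by
        have h1 : x * n * x⁻¹ = x * n * x⁻¹ * n⁻¹ * n := by simp
        rw [h1]
        exact mul_mem (Subgroup.mem_sup_right (hG x n)) hn⟩
      have hNH : N ⊔ H = ⊤ := hH.2 _ <| lt_of_le_of_ne le_sup_right fun h => hg <| h ▸
        Subgroup.mem_sup_left (Subgroup.mem_sup_left (Subgroup.mem_zpowers g))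
      refine HasLinearTowers.of_sup_eq_top N H hN hNH (ih _ ?_ H (fun a b => ?_) rfl)
      · rw [← Subgroup.card_top (G := G)]
        exact Set.ncard_lt_ncard (Set.ssubset_iff_exists.2 ⟨fun _ _ => trivial, g, trivial, hg⟩)
      · refine Subgroup.mem_center_iff.2 fun c => Subtype.ext ?_
        exact Subgroup.mem_center_iff.1 (hG a b) c

end Groups

/-! ### The invariant ring of a representation and its function field. -/

section LinearQuotient

variable {k V G : Type*} [Field k] [Group G] [AddCommGroup V] [Module k V]
  (ρ : Representation k G V)

@[simp]
theorem polynomialAction_ι (g : G) (f : Module.Dual k V) :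
    polynomialAction ρ g (SymmetricAlgebra.ι k _ f) = SymmetricAlgebra.ι k _ (ρ.dual g f) :=
  SymmetricAlgebra.lift_ι_apply _ _

theorem polynomialAction_one : polynomialAction ρ 1 = AlgHom.id k _ :=
  SymmetricAlgebra.algHom_ext (LinearMap.ext fun f => by
    change polynomialAction ρ 1 (SymmetricAlgebra.ι k _ f) = SymmetricAlgebra.ι k _ f
    rw [polynomialAction_ι, map_one]
    rfl)

theorem polynomialAction_mul (g h : G) :
    polynomialAction ρ (g * h) = (polynomialAction ρ g).comp (polynomialAction ρ h) :=
  SymmetricAlgebra.algHom_ext (LinearMap.ext fun f => by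
    change polynomialAction ρ (g * h) (SymmetricAlgebra.ι k _ f) =
      polynomialAction ρ g (polynomialAction ρ h (SymmetricAlgebra.ι k _ f))
    rw [polynomialAction_ι, polynomialAction_ι, polynomialAction_ι, map_mul]
    rfl)

/-- The action on the algebra of polynomial functions by automorphisms. -/
noncomputable def polynomialEquiv :
    G →* (SymmetricAlgebra k (Module.Dual k V) ≃ₐ[k] SymmetricAlgebra k (Module.Dual k V)) where
  toFun g := AlgEquiv.ofAlgHom (polynomialAction ρ g) (polynomialAction ρ g⁻¹)
    (by rw [← polynomialAction_mul, mul_inv_cancel, polynomialAction_one])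
    (by rw [← polynomialAction_mul, inv_mul_cancel, polynomialAction_one])
  map_one' := AlgEquiv.ext fun f => DFunLike.congr_fun (polynomialAction_one ρ) f
  map_mul' g h := AlgEquiv.ext fun f => DFunLike.congr_fun (polynomialAction_mul ρ g h) f

@[simp]
theorem polynomialEquiv_apply (g : G) (f : SymmetricAlgebra k (Module.Dual k V)) :
    polynomialEquiv ρ g f = polynomialAction ρ g f := rfl

theorem mem_invariantAlgebra {f : SymmetricAlgebra k (Module.Dual k V)} :
    f ∈ invariantAlgebra ρ ↔ ∀ g, polynomialAction ρ g f = f := by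
  simp [invariantAlgebra, Algebra.mem_iInf, AlgHom.mem_equalizer]

variable [FiniteDimensional k V]

instance : Algebra.FiniteType k (SymmetricAlgebra k (Module.Dual k V)) :=
  Algebra.FiniteType.equiv inferInstance
    (SymmetricAlgebra.equivMvPolynomial (Module.finBasis k (Module.Dual k V))).symm

/-- The algebra of invariants of a finite group is finitely generated. -/
theorem finiteType_invariantAlgebra [Finite G] : Algebra.FiniteType k (invariantAlgebra ρ) := by
  let S := SymmetricAlgebra k (Module.Dual k V)
  let _ : MulSemiringAction G S := MulSemiringAction.compHom S (polynomialEquiv ρ)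
  have hsmul : ∀ (g : G) (f : S), g • f = polynomialAction ρ g f := fun _ _ => rfl
  have : SMulCommClass G (invariantAlgebra ρ) S := ⟨fun g r f => by
    simp only [hsmul, Algebra.smul_def, map_mul]
    congr 1
    exact (mem_invariantAlgebra ρ).1 r.2 g⟩
  have : Algebra.IsInvariant (invariantAlgebra ρ) S G :=
    ⟨fun f hf => ⟨⟨f, (mem_invariantAlgebra ρ).2 hf⟩, rfl⟩⟩
  have : Algebra.IsIntegral (invariantAlgebra ρ) S := Algebra.IsInvariant.isIntegral _ S G
  have : Algebra.FiniteType (invariantAlgebra ρ) S :=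
    Algebra.FiniteType.of_restrictScalars_finiteType k _ S
  have : Module.Finite (invariantAlgebra ρ) S := Algebra.IsIntegral.finite
  -- The Artin–Tate lemma: the polynomial algebra is finitely generated over `k` and finite over the
  -- invariants.
  exact ⟨fg_of_fg_of_fg k (invariantAlgebra ρ) S Algebra.FiniteType.out Module.Finite.fg_top
    Subtype.val_injective⟩

end LinearQuotient

/-! ### From linear actions on fields to quotients of representations. -/

section LinearField

variable {k V : Type u} {G : Type*} [Field k] [Group G] [AddCommGroup V] [Module k V]
  [FiniteDimensional k V] (ρ : Representation k G V)

/-- The action on the field of rational functions on a representation. -/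
noncomputable abbrev rationalFunctionAction :
    G →* (FractionRing (SymmetricAlgebra k (Module.Dual k V)) ≃ₐ[k]
      FractionRing (SymmetricAlgebra k (Module.Dual k V))) :=
  fractionAction _ (polynomialEquiv ρ)

/-- The field of rational functions on a representation is a linear action. -/
theorem isLinearAction_rationalFunctionAction :
    IsLinearAction (rationalFunctionAction ρ).range.subtype := by
  set S := SymmetricAlgebra k (Module.Dual k V)
  set Ω := FractionRing S
  let b := Module.finBasis k (Module.Dual k V)
  let n := Module.finrank k (Module.Dual k V)
  let x : ULift.{u} (Fin n) → Ω := fun i =>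
    algebraMap S Ω (SymmetricAlgebra.ι k (Module.Dual k V) (b i.down))
  let e := SymmetricAlgebra.equivMvPolynomial b
  refine ⟨Subtype.val_injective, ULift.{u} (Fin n), inferInstance, x, ?_, ?_, ?_⟩
  · have h1 : AlgebraicIndependent k fun i => SymmetricAlgebra.ι k (Module.Dual k V) (b i) := by
      have h2 := (MvPolynomial.algebraicIndependent_X (Fin n) k).map'
        (f := (e.symm : MvPolynomial (Fin n) k →ₐ[k] S)) e.symm.injective
      convert h2 using 2 with i
      exact (SymmetricAlgebra.equivMvPolynomial_symm_X b i).symm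
    exact (h1.map' (f := IsScalarTower.toAlgHom k S Ω) (IsFractionRing.injective S Ω)).comp _
      ULift.down_injective
  · have hS : ∀ s : S, algebraMap S Ω s ∈ IntermediateField.adjoin k (Set.range x) := by
      intro s
      obtain ⟨p, rfl⟩ := e.symm.surjective s
      induction p using MvPolynomial.induction_on with
      | C a =>
        have h1 : e.symm (MvPolynomial.C a) = algebraMap k S a := e.symm.commutes a
        rw [h1, ← IsScalarTower.algebraMap_apply k S Ω]
        exact IntermediateField.algebraMap_mem _ a
      | add p q hp hq => rw [map_add, map_add]; exact add_mem hp hq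
      | mul_X p i hp =>
        rw [map_mul, map_mul, SymmetricAlgebra.equivMvPolynomial_symm_X]
        exact mul_mem hp (IntermediateField.subset_adjoin k _ ⟨⟨i⟩, rfl⟩)
    refine eq_top_iff.2 fun f _ => ?_
    obtain ⟨a, b, -, rfl⟩ := IsFractionRing.div_surjective (A := S) f
    exact div_mem (hS a) (hS b)
  · rintro ⟨_, g, rfl⟩ i
    change rationalFunctionAction ρ g (x i) ∈ _
    rw [fractionAction_algebraMap, polynomialEquiv_apply, polynomialAction_ι]
    let f : Module.Dual k V →ₗ[k] Ω :=
      (IsScalarTower.toAlgHom k S Ω).toLinearMap ∘ₗ SymmetricAlgebra.ι k (Module.Dual k V)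
    have hx : Set.range x = f '' Set.range b := by
      rw [← Set.range_comp]
      exact (Equiv.ulift (α := Fin n)).surjective.range_comp (f ∘ b)
    rw [hx]
    exact Submodule.apply_mem_span_image_of_mem_span f (b.span_eq.symm ▸ trivial)

/-- The quotient of a linear representation has a tower if all linear quotients by the group of
induced automorphisms do. -/
theorem admitsToricRationalTower_linearQuotientStr [Finite G]
    (h : HasLinearTowers k (rationalFunctionAction ρ).range) :
    AdmitsToricRationalTower (linearQuotientStr ρ) := by
  have := finiteType_invariantAlgebra ρ
  refine Variety.HasToricTower.admits (h _ _ (isLinearAction_rationalFunctionAction ρ) _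
    ((IsScalarTower.toAlgHom k (SymmetricAlgebra k (Module.Dual k V)) _).comp
      (invariantAlgebra ρ).val) ((IsFractionRing.injective (SymmetricAlgebra k
      (Module.Dual k V)) _).comp Subtype.val_injective) ?_ ?_)
  · rintro ⟨_, g, rfl⟩ r
    refine (fractionAction_algebraMap (polynomialEquiv ρ) g _).trans ?_
    exact congrArg _ ((mem_invariantAlgebra ρ).1 r.2 g)
  · intro f hf
    obtain ⟨a, b, ha, hb, hb0, hab⟩ := exists_fixed_of_fractionAction_eq (polynomialEquiv ρ) f
      fun g => hf ⟨_, g, rfl⟩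
    exact ⟨⟨a, (mem_invariantAlgebra ρ).2 ha⟩, ⟨b, (mem_invariantAlgebra ρ).2 hb⟩,
      fun h0 => hb0 (congrArg Subtype.val h0), hab⟩

end LinearField

/-- A commutator in `Gc` dies in the abelian group `A`, so it is central. This property passes to
the image of `Gc` in the automorphisms of `k(V)`, which acts faithfully by construction and has the
same invariants. -/
theorem mainTheorem2 {k : Type u} [Field k] [IsAlgClosed k] [CharZero k]
    {ℓ : ℕ} (hℓ : ℓ.Prime)
    {Gc A : Type*} [Group Gc] [Finite Gc] [CommGroup A]
    (hGc : IsPGroup ℓ Gc) (hA : IsPGroup ℓ A)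
    (π : Gc →* A) (hπ : Function.Surjective π) (hcentral : π.ker ≤ Subgroup.center Gc)
    {V : Type u} [AddCommGroup V] [Module k V] [FiniteDimensional k V]
    (ρ : Representation k Gc V) (hρ : Function.Injective ρ) :
    AdmitsToricRationalTower (linearQuotientStr ρ) := by
  have : Finite (rationalFunctionAction ρ).range :=
    Finite.of_surjective _ (rationalFunctionAction ρ).rangeRestrict_surjective
  refine admitsToricRationalTower_linearQuotientStr ρ (hasLinearTowers_of_commutator_le_center _ ?_)
  rintro ⟨_, a, rfl⟩ ⟨_, b, rfl⟩
  have hab : a * b * a⁻¹ * b⁻¹ ∈ Subgroup.center Gc :=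
    hcentral (by simp [MonoidHom.mem_ker, mul_comm (π a) (π b)])
  refine Subgroup.mem_center_iff.2 ?_
  rintro ⟨_, c, rfl⟩
  refine Subtype.ext ?_
  simpa using congrArg (rationalFunctionAction ρ) (Subgroup.mem_center_iff.1 hab c)
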